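/- Let $f$ be a real polynomial of degree $k\ge 1$ with irrational leading coefficient, let $\gamma=4^{1-k}$, and let $\varepsilon>0$. Write $\|x\|$ for the distance from the real number $x$ to the nearest integer. Then there are infinitely many positive integers $n$ that are squarefree and have at least two prime factors such that $$\|f(n)\|<n^{-\gamma/4+\varepsilon}.$$ -/

import Mathlib

/-- The distance `‖x‖` from a real number `x` to the nearest integer. -/
noncomputable def distNearestInt (x : ℝ) : ℝ := |x - (round x : ℝ)|

/-- The quantity `γ = 4 ^ (1 - k)` attached to a polynomial of degree `k`
(the exponent `1 - k` is an integer, so there is no truncated subtraction). -/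
noncomputable def gammaExp (k : ℕ) : ℝ := (4 : ℝ) ^ (1 - (k : ℤ))

open Finset

/-! Let α be the leading coefficient and take n = 2(2m + 1) with 2m + 1 squarefree; the factor 2
supplies a second prime. Suppose ‖f(n)‖ ≥ δ for all such n with m < M, apart from boundedly many.
Let K(x) = |∑_{a<H} exp(2πiax)|^(2r), a nonnegative trigonometric polynomial with constant term W,
which is tiny where ‖x‖ ≥ δ because H is much longer than 1/δ.

If f equidistributes well, K(f(n)) summed over all odd 2m + 1 is about WM, while the values
divisible by the square of an odd d ≥ 3 account for at most about WM/2, since ∑ 1/(2j(j+1)) = 1/2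
with d = 2j + 1. The squarefree values must then contribute about WM/2, although K is tiny there.
Hence some exponential sum along multiples of an odd square is large
(`half_le_sum_norm_of_forall_le_distNearestInt`).

Weyl's method excludes this (`sum_norm_progression_le`). After differencing, the shifts and the
frequency are collected into one variable at the cost of a divisor bound (`sum_weylBound_le`),
leaving a sum of 1/‖nα‖. The denominator q of a rational approximation to α is taken so large that
only n ≤ q/4 occurs, and one residue count suffices (`sum_one_div_distNearestInt_le`). All
parameters are powers of one integer y, with M = y^(4^k t), 1/δ = y^(t-4), H = y^(t-3) and q about
y^E. -/

/-! ### Additive characters and geometric sums. -/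

/-- The additive character `x ↦ exp (2πix)`. -/
noncomputable def expTurn (x : ℝ) : ℂ := Complex.exp (Complex.I * ((2 * Real.pi * x : ℝ) : ℂ))

lemma expTurn_add (x y : ℝ) : expTurn (x + y) = expTurn x * expTurn y := by
  rw [expTurn, expTurn, expTurn, ← Complex.exp_add]
  congr 1
  push_cast
  ring

lemma expTurn_zero : expTurn 0 = 1 := by simp [expTurn]

lemma norm_expTurn (x : ℝ) : ‖expTurn x‖ = 1 := by
  rw [expTurn, mul_comm, Complex.norm_exp_ofReal_mul_I]

lemma conj_expTurn (x : ℝ) : (starRingEnd ℂ) (expTurn x) = expTurn (-x) := by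
  rw [expTurn, expTurn, ← Complex.exp_conj, map_mul, Complex.conj_I, Complex.conj_ofReal]
  congr 1
  push_cast
  ring

lemma expTurn_nat_mul (n : ℕ) (x : ℝ) : expTurn (n * x) = expTurn x ^ n := by
  rw [expTurn, expTurn, ← Complex.exp_nat_mul]
  congr 1
  push_cast
  ring

lemma expTurn_intCast (n : ℤ) : expTurn n = 1 := by
  rw [expTurn, Complex.exp_eq_one_iff]
  exact ⟨n, by push_cast; ring⟩

lemma distNearestInt_nonneg (x : ℝ) : 0 ≤ distNearestInt x := abs_nonneg _

lemma distNearestInt_ne_zero {x : ℝ} (hx : Irrational x) : distNearestInt x ≠ 0 := by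
  rw [distNearestInt, abs_ne_zero, sub_ne_zero]
  exact hx.ne_int _

lemma four_mul_distNearestInt_le (x : ℝ) : 4 * distNearestInt x ≤ ‖expTurn x - 1‖ := by
  have h1 : expTurn x = expTurn (x - round x) := by
    have := expTurn_add (x - round x) (round x)
    rw [sub_add_cancel, expTurn_intCast, mul_one] at this
    exact this
  rw [h1, expTurn, Complex.norm_exp_I_mul_ofReal_sub_one, distNearestInt]
  set t := x - round x with ht
  have hle : |t| ≤ 1 / 2 := abs_sub_round x
  have h2 : 2 * Real.pi * t / 2 = Real.pi * t := by ring
  rw [h2, norm_mul, Real.norm_eq_abs, Real.norm_eq_abs, abs_two]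
  have hpi := Real.pi_pos
  have h3 : |Real.sin (Real.pi * t)| = Real.sin (Real.pi * |t|) := by
    have h4 : 0 ≤ Real.sin (Real.pi * |t|) :=
      Real.sin_nonneg_of_nonneg_of_le_pi (by positivity) (by nlinarith [abs_nonneg t])
    rcases abs_cases t with ⟨h, _⟩ | ⟨h, _⟩
    · rw [h] at h4 ⊢
      exact abs_of_nonneg h4
    · rw [h] at h4 ⊢
      rw [mul_neg, Real.sin_neg] at h4 ⊢
      exact abs_of_nonpos (by linarith)
  rw [h3]
  have h5 := Real.mul_le_sin (x := Real.pi * |t|) (by positivity) (by nlinarith)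
  have h6 : 2 / Real.pi * (Real.pi * |t|) = 2 * |t| := by field_simp
  linarith

lemma norm_sum_expTurn_pow_le (b : ℝ) (hb : distNearestInt b ≠ 0) (L : ℕ) :
    ‖∑ n ∈ range L, expTurn b ^ n‖ ≤ 1 / (2 * distNearestInt b) := by
  have hpos : 0 < distNearestInt b := lt_of_le_of_ne (distNearestInt_nonneg b) (Ne.symm hb)
  have h4 := four_mul_distNearestInt_le b
  have h := geom_sum_mul (expTurn b) L
  have h2 : ‖∑ n ∈ range L, expTurn b ^ n‖ * ‖expTurn b - 1‖ ≤ 2 := by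
    rw [← norm_mul, h]
    calc ‖expTurn b ^ L - 1‖ ≤ ‖expTurn b ^ L‖ + ‖(1 : ℂ)‖ := norm_sub_le _ _
      _ = 2 := by rw [norm_pow, norm_expTurn]; norm_num
  rw [le_div_iff₀ (by positivity)]
  nlinarith [norm_nonneg (∑ n ∈ range L, expTurn b ^ n)]

lemma norm_sum_expTurn_linear_le (b c : ℝ) (hb : distNearestInt b ≠ 0) (L : ℕ) :
    ‖∑ n ∈ range L, expTurn (b * n + c)‖ ≤ 1 / (2 * distNearestInt b) := by
  have : ∑ n ∈ range L, expTurn (b * n + c) = (∑ n ∈ range L, expTurn b ^ n) * expTurn c := by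
    rw [sum_mul]
    refine sum_congr rfl fun n _ => ?_
    rw [expTurn_add, mul_comm b, expTurn_nat_mul]
  rw [this, norm_mul, norm_expTurn, mul_one]
  exact norm_sum_expTurn_pow_le b hb L

lemma norm_sum_expTurn_le (φ : ℕ → ℝ) (L : ℕ) : ‖∑ n ∈ range L, expTurn (φ n)‖ ≤ L := by
  refine (norm_sum_le _ _).trans ?_
  simp [norm_expTurn]

/-! ### Weyl differencing. -/

lemma norm_sq_add (a b : ℂ) :
    ‖a + b‖ ^ 2 = ‖a‖ ^ 2 + ‖b‖ ^ 2 + 2 * (b * (starRingEnd ℂ) a).re := by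
  rw [← Complex.normSq_eq_norm_sq, ← Complex.normSq_eq_norm_sq, ← Complex.normSq_eq_norm_sq,
    Complex.normSq_add]
  simp only [Complex.mul_re, Complex.conj_re, Complex.conj_im]
  ring

/-- Expansion of the square of a sum by differences of the indices. -/
lemma norm_sq_sum_range (z : ℕ → ℂ) (J : ℕ) :
    ‖∑ j ∈ range J, z j‖ ^ 2 = ∑ j ∈ range J, ‖z j‖ ^ 2 +
      2 * (∑ u ∈ Ico 1 J, ∑ j ∈ range (J - u), z (j + u) * (starRingEnd ℂ) (z j)).re := by
  induction J with
  | zero => simp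
  | succ J ih =>
    have h1 : ∑ u ∈ Ico 1 (J + 1), ∑ j ∈ range (J + 1 - u), z (j + u) * (starRingEnd ℂ) (z j)
        = ∑ u ∈ Ico 1 J, ∑ j ∈ range (J - u), z (j + u) * (starRingEnd ℂ) (z j)
          + z J * (starRingEnd ℂ) (∑ j ∈ range J, z j) := by
      have h2 : ∀ u ∈ Ico 1 (J + 1),
          ∑ j ∈ range (J + 1 - u), z (j + u) * (starRingEnd ℂ) (z j)
          = ∑ j ∈ range (J - u), z (j + u) * (starRingEnd ℂ) (z j)
            + z J * (starRingEnd ℂ) (z (J - u)) := by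
        intro u hu
        rw [mem_Ico] at hu
        rw [show J + 1 - u = (J - u) + 1 by omega, sum_range_succ, show J - u + u = J by omega]
      rw [sum_congr rfl h2, sum_add_distrib]
      congr 1
      · rcases Nat.eq_zero_or_pos J with rfl | hJ
        · simp
        · rw [sum_Ico_succ_top hJ]
          simp
      · rw [← mul_sum, ← map_sum]
        congr 2
        rw [sum_Ico_eq_sum_range, Nat.add_sub_cancel, ← sum_range_reflect z J]
        refine sum_congr rfl fun j _ => ?_
        congr 1
        omega
    rw [sum_range_succ, norm_sq_add, ih, sum_range_succ, h1, Complex.add_re]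
    ring

/-- The diagonal equals the term u = 0, so admitting that shift with the common factor 2 absorbs it.
-/
lemma norm_sq_sum_expTurn_le (φ : ℕ → ℝ) {L N : ℕ} (hL : L ≤ N) :
    ‖∑ n ∈ range L, expTurn (φ n)‖ ^ 2 ≤
      2 * ∑ u ∈ range N, ‖∑ n ∈ range (L - u), expTurn (φ (n + u) - φ n)‖ := by
  rw [norm_sq_sum_range]
  have h1 : ∑ j ∈ range L, ‖expTurn (φ j)‖ ^ 2 = (L : ℝ) := by simp [norm_expTurn]
  rw [h1]
  have h2 : ∀ a b : ℝ, expTurn a * (starRingEnd ℂ) (expTurn b) = expTurn (a - b) := by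
    intro a b
    rw [conj_expTurn, ← expTurn_add, sub_eq_add_neg]
  simp only [h2]
  have h3 := Complex.re_le_norm
    (∑ u ∈ Ico 1 L, ∑ j ∈ range (L - u), expTurn (φ (j + u) - φ j))
  have h4 := norm_sum_le (Ico 1 L) fun u => ∑ j ∈ range (L - u), expTurn (φ (j + u) - φ j)
  set F : ℕ → ℝ := fun u => ‖∑ n ∈ range (L - u), expTurn (φ (n + u) - φ n)‖ with hF
  have hF0 : F 0 = L := by simp [hF, expTurn_zero]
  have h5 : ∑ u ∈ range L, F u ≤ ∑ u ∈ range N, F u :=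
    sum_le_sum_of_subset_of_nonneg (range_subset_range.2 hL) fun _ _ _ => norm_nonneg _
  have h6 : (L : ℝ) + ∑ u ∈ Ico 1 L, F u = ∑ u ∈ range L, F u := by
    rcases Nat.eq_zero_or_pos L with h | h
    · subst h; simp
    · rw [range_eq_Ico, sum_eq_sum_Ico_succ_bot h, hF0]
  have h7 : (0 : ℝ) ≤ L := Nat.cast_nonneg L
  linarith

/-- A bound for linear exponential sums of length at most `N` with frequency `b`. -/
noncomputable def linearBound (N : ℕ) (b : ℝ) : ℝ :=
  if distNearestInt b = 0 then N else 1 / distNearestInt b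

/-- The iterated sum that bounds exponential sums of degree `j + 1` after Weyl differencing. -/
noncomputable def weylBound (N : ℕ) : ℕ → ℝ → ℝ
  | 0, b => linearBound N b
  | j + 1, b => ∑ u ∈ range N, weylBound N j (((j + 2 : ℕ) : ℝ) * (u * b))

lemma linearBound_nonneg (N : ℕ) (b : ℝ) : 0 ≤ linearBound N b := by
  have := distNearestInt_nonneg b
  rw [linearBound]
  split_ifs <;> positivity

lemma weylBound_nonneg (N j : ℕ) (b : ℝ) : 0 ≤ weylBound N j b := by
  induction j generalizing b with
  | zero => exact linearBound_nonneg N b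
  | succ j ih => exact sum_nonneg fun u _ => ih _

lemma weylBound_zero_right (N j : ℕ) : weylBound N j 0 = (N : ℝ) ^ (j + 1) := by
  induction j with
  | zero => simp [weylBound, linearBound, distNearestInt]
  | succ j ih =>
    simp only [weylBound, mul_zero, ih, sum_const, card_range, nsmul_eq_mul]
    ring

lemma norm_sum_expTurn_le_linearBound {L N : ℕ} (hL : L ≤ N) (b c : ℝ) :
    ‖∑ n ∈ range L, expTurn (b * n + c)‖ ≤ linearBound N b := by
  rw [linearBound]
  split_ifs with h
  · exact (norm_sum_expTurn_le _ L).trans (by exact_mod_cast hL)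
  · refine (norm_sum_expTurn_linear_le b c h L).trans ?_
    have hpos : 0 < distNearestInt b := lt_of_le_of_ne (distNearestInt_nonneg b) (Ne.symm h)
    gcongr
    linarith

lemma coeff_taylor_sub_of_natDegree_le {P : Polynomial ℝ} {j : ℕ} (hP : P.natDegree ≤ j + 1)
    (u : ℝ) : (Polynomial.taylor u P - P).natDegree ≤ j ∧
      (Polynomial.taylor u P - P).coeff j = ((j + 1 : ℕ) : ℝ) * (u * P.coeff (j + 1)) := by
  constructor
  · rw [Polynomial.natDegree_le_iff_coeff_eq_zero]
    intro n hn
    rw [Polynomial.coeff_sub]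
    rcases (show j + 1 ≤ n by omega).eq_or_lt with h | h
    · subst h
      rcases hP.eq_or_lt with h' | h'
      · rw [← h', Polynomial.coeff_taylor_natDegree, Polynomial.leadingCoeff, sub_self]
      · rw [Polynomial.coeff_eq_zero_of_natDegree_lt h',
          Polynomial.coeff_eq_zero_of_natDegree_lt (by rwa [Polynomial.natDegree_taylor]), sub_self]
    · rw [Polynomial.coeff_eq_zero_of_natDegree_lt (hP.trans_lt h),
        Polynomial.coeff_eq_zero_of_natDegree_lt
          (by rw [Polynomial.natDegree_taylor]; exact hP.trans_lt h), sub_self]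
  · rw [Polynomial.coeff_sub, Polynomial.taylor_coeff]
    have hdeg : (Polynomial.hasseDeriv j P).natDegree ≤ 1 :=
      (Polynomial.natDegree_hasseDeriv_le P j).trans (by omega)
    rw [Polynomial.eval_eq_sum_range' (Nat.lt_succ_of_le hdeg)]
    simp only [sum_range_succ, range_zero, sum_empty, Polynomial.hasseDeriv_coeff]
    simp [add_comm 1 j]
    ring

/-- Weyl's inequality, before the multiple sum is estimated. -/
lemma weyl_inequality {N : ℕ} (j : ℕ) : ∀ {L : ℕ} (_ : L ≤ N) {P : Polynomial ℝ}
    (_ : P.natDegree ≤ j + 1),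
    (N : ℝ) ^ (j + 1) * ‖∑ n ∈ range L, expTurn (P.eval (n : ℝ))‖ ^ (2 ^ j) ≤
      (2 * N : ℝ) ^ (2 ^ j) * weylBound N j (P.coeff (j + 1)) := by
  induction j with
  | zero =>
    intro L hL P hP
    have h : ∀ n : ℕ, P.eval (n : ℝ) = P.coeff 1 * n + P.coeff 0 := by
      intro n
      rw [Polynomial.eval_eq_sum_range' (Nat.lt_succ_of_le hP)]
      simp [sum_range_succ]
      ring
    simp only [h]
    have h1 := norm_sum_expTurn_le_linearBound hL (P.coeff 1) (P.coeff 0)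
    have h2 := linearBound_nonneg N (P.coeff 1)
    simp only [weylBound, pow_zero, pow_one, zero_add]
    have h3 : (0 : ℝ) ≤ N := Nat.cast_nonneg N
    nlinarith
  | succ j ih =>
    intro L hL P hP
    set J := 2 ^ j with hJ
    have hJ0 : J ≠ 0 := by positivity
    set S := ‖∑ n ∈ range L, expTurn (P.eval (n : ℝ))‖ with hS
    set T : ℕ → ℝ := fun u =>
      ‖∑ n ∈ range (L - u), expTurn ((Polynomial.taylor (u : ℝ) P - P).eval (n : ℝ))‖ with hT
    have h1 : S ^ 2 ≤ 2 * ∑ u ∈ range N, T u := by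
      refine (norm_sq_sum_expTurn_le (fun n : ℕ => P.eval (n : ℝ)) hL).trans_eq ?_
      simp only [hT, Polynomial.eval_sub, Polynomial.taylor_eval, Nat.cast_add]
    have hT0 : ∀ u, 0 ≤ T u := fun u => norm_nonneg _
    have h2 : ∀ u ∈ range N, (N : ℝ) ^ (j + 1) * T u ^ J ≤
        (2 * N : ℝ) ^ J * weylBound N j (((j + 2 : ℕ) : ℝ) * (u * P.coeff (j + 2))) := by
      intro u _
      obtain ⟨h3, h4⟩ := coeff_taylor_sub_of_natDegree_le hP (u : ℝ)
      have := ih (L := L - u) (by omega) h3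
      rw [h4] at this
      exact this
    -- Power mean inequality over the N shifts; it passes the exponent 2^j inside the sum so that
    -- the inductive bound applies to each shift.
    have h3 : (∑ u ∈ range N, T u) ^ J * N ≤ (N : ℝ) ^ J * ∑ u ∈ range N, T u ^ J := by
      rcases Nat.eq_zero_or_pos N with h0 | h0
      · simp [h0]
      obtain ⟨J', hJ'⟩ := Nat.exists_eq_succ_of_ne_zero hJ0
      have h := pow_sum_div_card_le_sum_pow (s := range N) (f := T) (fun u _ => hT0 u) J'
      rw [card_range, div_le_iff₀ (by positivity)] at h
      rw [hJ', Nat.succ_eq_add_one]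
      calc (∑ u ∈ range N, T u) ^ (J' + 1) * N ≤ (∑ u ∈ range N, T u ^ (J' + 1)) * N ^ J' * N := by
            gcongr
        _ = _ := by ring
    have hN : (0 : ℝ) ≤ N := Nat.cast_nonneg N
    have hS0 : 0 ≤ S := norm_nonneg _
    have hsum0 : 0 ≤ ∑ u ∈ range N, T u := sum_nonneg fun u _ => hT0 u
    calc (N : ℝ) ^ (j + 1 + 1) * S ^ (2 ^ (j + 1))
        = (N : ℝ) ^ (j + 1) * N * (S ^ 2) ^ J := by
          rw [← pow_mul, hJ, pow_succ 2 j, mul_comm (2 ^ j) 2]; ring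
      _ ≤ (N : ℝ) ^ (j + 1) * N * (2 * ∑ u ∈ range N, T u) ^ J := by gcongr
      _ = (N : ℝ) ^ (j + 1) * 2 ^ J * ((∑ u ∈ range N, T u) ^ J * N) := by rw [mul_pow]; ring
      _ ≤ (N : ℝ) ^ (j + 1) * 2 ^ J * ((N : ℝ) ^ J * ∑ u ∈ range N, T u ^ J) := by gcongr
      _ = (2 * N : ℝ) ^ J * ∑ u ∈ range N, (N : ℝ) ^ (j + 1) * T u ^ J := by
          rw [← mul_sum, mul_pow]; ring
      _ ≤ (2 * N : ℝ) ^ J * ∑ u ∈ range N, (2 * N : ℝ) ^ J *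
            weylBound N j (((j + 2 : ℕ) : ℝ) * (u * P.coeff (j + 2))) := by
          exact mul_le_mul_of_nonneg_left (sum_le_sum h2) (by positivity)
      _ = (2 * N : ℝ) ^ (2 ^ (j + 1)) * weylBound N (j + 1) (P.coeff (j + 1 + 1)) := by
          rw [← mul_sum, weylBound, pow_succ 2 j, mul_comm (2 ^ j) 2, two_mul (2 ^ j), pow_add,
            ← hJ]
          ring

/-! ### Divisor bound and averages of the Weyl bound. -/

lemma succ_pow_le_mul_two_pow (m a : ℕ) : (a + 1) ^ m ≤ m.factorial * 2 ^ m * 2 ^ a := by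
  calc (a + 1) ^ m ≤ (a + 1).ascFactorial m := Nat.pow_succ_le_ascFactorial (a + 1) m
    _ = m.factorial * (a + m).choose m := Nat.ascFactorial_eq_factorial_mul_choose a m
    _ ≤ m.factorial * 2 ^ (a + m) := by gcongr; exact Nat.choose_le_two_pow _ _
    _ = _ := by rw [pow_add]; ring

/-- The divisor bound, in the form `τ(n) ^ m ≪ n`. -/
lemma exists_card_divisors_pow_le (m : ℕ) : ∃ C : ℕ, ∀ n : ℕ, n ≠ 0 → #n.divisors ^ m ≤ C * n := by
  set c := m.factorial * 2 ^ m with hc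
  have hc1 : 1 ≤ c := Nat.succ_le_of_lt (by positivity)
  refine ⟨c ^ 2 ^ m, fun n hn => ?_⟩
  -- For p ≥ 2^m the local factor is at most p^a with no loss; only the fewer than 2^m smaller
  -- primes cost a constant.
  have hterm : ∀ p ∈ n.primeFactors, (n.factorization p + 1) ^ m ≤
      (if p < 2 ^ m then c else 1) * p ^ n.factorization p := by
    intro p hp
    have hp2 : 2 ≤ p := (Nat.prime_of_mem_primeFactors hp).two_le
    split_ifs with h
    · exact (succ_pow_le_mul_two_pow m _).trans (by gcongr)
    · rw [one_mul]
      calc (n.factorization p + 1) ^ m ≤ (2 ^ n.factorization p) ^ m := by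
            gcongr; exact Nat.lt_two_pow_self
        _ = (2 ^ m) ^ n.factorization p := by rw [← pow_mul, ← pow_mul, mul_comm]
        _ ≤ p ^ n.factorization p := by gcongr; omega
  have hprod : ∏ p ∈ n.primeFactors, (if p < 2 ^ m then c else 1) ≤ c ^ 2 ^ m := by
    rw [← prod_filter, prod_const]
    refine Nat.pow_le_pow_right hc1 ?_
    calc #{p ∈ n.primeFactors | p < 2 ^ m} ≤ #(range (2 ^ m)) :=
          card_le_card fun p hp => by simp at hp ⊢; exact hp.2
      _ = 2 ^ m := card_range _
  rw [Nat.card_divisors hn, ← prod_pow]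
  calc ∏ p ∈ n.primeFactors, (n.factorization p + 1) ^ m
      ≤ ∏ p ∈ n.primeFactors, (if p < 2 ^ m then c else 1) * p ^ n.factorization p :=
        prod_le_prod' hterm
    _ = (∏ p ∈ n.primeFactors, (if p < 2 ^ m then c else 1)) * n := by
        rw [prod_mul_distrib]
        congr 1
        exact Nat.prod_factorization_pow_eq_self hn
    _ ≤ c ^ 2 ^ m * n := by gcongr

lemma exists_card_divisors_le (E : ℕ) :
    ∃ Y : ℕ, ∀ y ≥ Y, ∀ n : ℕ, n ≠ 0 → n ≤ y ^ E → #n.divisors ≤ y := by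
  obtain ⟨C, hC⟩ := exists_card_divisors_pow_le (E + 1)
  refine ⟨C, fun y hy n hn hle => ?_⟩
  refine le_of_pow_le_pow_left₀ (Nat.succ_ne_zero E) (Nat.zero_le y) ?_
  calc #n.divisors ^ (E + 1) ≤ C * n := hC n hn
    _ ≤ y * y ^ E := Nat.mul_le_mul hy hle
    _ = y ^ (E + 1) := by ring

/-- A pair (u, h) with product n is determined by the divisor u, so each n occurs at most B times.
-/
lemma sum_sum_mul_le_of_card_divisors_le {N X B : ℕ} {G : ℕ → ℝ} (hG : ∀ n, 0 ≤ G n)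
    (hB : ∀ n, n ≠ 0 → n ≤ X * N → #n.divisors ≤ B) :
    ∑ u ∈ Ico 1 N, ∑ h ∈ Icc 1 X, G (u * h) ≤ B * ∑ n ∈ Icc 1 (X * N), G n := by
  rw [← sum_product', ← sum_fiberwise_of_maps_to (g := fun p : ℕ × ℕ => p.1 * p.2)
    (t := Icc 1 (X * N)), mul_sum]
  · refine sum_le_sum fun n hn => ?_
    rw [mem_Icc] at hn
    rw [sum_congr rfl (g := fun _ => G n) (fun p hp => by rw [(mem_filter.1 hp).2]), sum_const,
      nsmul_eq_mul]
    refine mul_le_mul_of_nonneg_right ?_ (hG n)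
    have hn0 : n ≠ 0 := by omega
    refine Nat.cast_le.2 (le_trans ?_ (hB n hn0 hn.2))
    refine card_le_card_of_injOn Prod.fst ?_ ?_
    · intro p hp
      have hp2 := (mem_filter.1 hp).2
      exact Nat.mem_divisors.2 ⟨⟨p.2, hp2.symm⟩, hn0⟩
    · intro p hp p' hp' h
      have h1 := (mem_filter.1 hp)
      have h2 := (mem_filter.1 hp')
      have h3 : 0 < p.1 := (mem_Ico.1 (mem_product.1 h1.1).1).1
      refine Prod.ext h ?_
      have h4 : p.1 * p.2 = p.1 * p'.2 := by rw [h1.2, h, h2.2]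
      exact Nat.eq_of_mul_eq_mul_left h3 h4
  · intro p hp
    obtain ⟨h1, h2⟩ := mem_product.1 hp
    rw [mem_Ico] at h1
    rw [mem_Icc] at h2 ⊢
    exact ⟨Nat.mul_pos h1.1 h2.1, by rw [mul_comm]; exact Nat.mul_le_mul h2.2 h1.2.le⟩

/-- Each differencing step merges its nonzero shift with h into one variable at the cost of a factor
B, and its numerical factor is absorbed into the factorial. A zero shift kills the leading
coefficient; these degenerate terms make up `j * X * N ^ j`. -/
lemma sum_weylBound_le {N B : ℕ} (hN : 1 ≤ N) (hB1 : 1 ≤ B) (j : ℕ) : ∀ (X : ℕ) (b : ℝ)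
    (_ : ∀ n, n ≠ 0 → n ≤ X * N ^ j → #n.divisors ≤ B),
    ∑ h ∈ Icc 1 X, weylBound N j (h * b) ≤ (B : ℝ) ^ j * (j * X * N ^ j +
      ∑ r ∈ Icc 1 (X * N ^ j), linearBound N ((((j + 1).factorial * r : ℕ) : ℝ) * b)) := by
  induction j with
  | zero => intro X b _; simp [weylBound]
  | succ j ih =>
    intro X b hB
    set G : ℕ → ℝ := fun n => weylBound N j (n * (((j + 2 : ℕ) : ℝ) * b)) with hG
    have hNj : 1 ≤ N ^ j := Nat.one_le_pow _ _ hN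
    have h1 : ∑ h ∈ Icc 1 X, weylBound N (j + 1) (h * b) =
        X * N ^ (j + 1) + ∑ u ∈ Ico 1 N, ∑ h ∈ Icc 1 X, G (u * h) := by
      have h2 : ∀ h ∈ Icc 1 X, weylBound N (j + 1) (h * b) =
          (N : ℝ) ^ (j + 1) + ∑ u ∈ Ico 1 N, G (u * h) := by
        intro h _
        rw [weylBound, range_eq_Ico, sum_eq_sum_Ico_succ_bot hN]
        congr 1
        · simp only [Nat.cast_zero, zero_mul, mul_zero, weylBound_zero_right]
        · refine sum_congr rfl fun u _ => ?_
          simp only [hG]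
          congr 1
          push_cast
          ring
      rw [sum_congr rfl h2, sum_add_distrib, sum_comm]
      simp
    have h2 := sum_sum_mul_le_of_card_divisors_le (N := N) (X := X) (B := B) (G := G)
      (fun n => weylBound_nonneg _ _ _) (fun n hn hle => hB n hn (hle.trans (by
        rw [pow_succ']
        exact Nat.mul_le_mul_left X (Nat.le_mul_of_pos_right N hNj))))
    have h3 := ih (X * N) (((j + 2 : ℕ) : ℝ) * b) (fun n hn hle => hB n hn (hle.trans_eq (by ring)))
    have h4 : ∑ r ∈ Icc 1 (X * N * N ^ j),
          linearBound N ((((j + 1).factorial * r : ℕ) : ℝ) * (((j + 2 : ℕ) : ℝ) * b)) =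
        ∑ r ∈ Icc 1 (X * N ^ (j + 1)),
          linearBound N ((((j + 1 + 1).factorial * r : ℕ) : ℝ) * b) := by
      rw [show X * N * N ^ j = X * N ^ (j + 1) by ring]
      refine sum_congr rfl fun r _ => ?_
      rw [Nat.factorial_succ (j + 1)]
      congr 1
      push_cast
      ring
    rw [h4] at h3
    have hB1' : (1 : ℝ) ≤ (B : ℝ) ^ (j + 1) := one_le_pow₀ (by exact_mod_cast hB1)
    have h5 : (X : ℝ) * N ^ (j + 1) ≤ B ^ (j + 1) * (X * N ^ (j + 1)) :=
      le_mul_of_one_le_left (by positivity) hB1'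
    rw [h1]
    have h6 := mul_le_mul_of_nonneg_left h3 (Nat.cast_nonneg (α := ℝ) B)
    refine (add_le_add h5 (h2.trans h6)).trans_eq ?_
    push_cast
    ring

/-! ### Sums of reciprocal distances and rational approximation. -/

/-- For n ≤ q/4 the residues of na modulo q are distinct and nonzero, and replacing α by a/q shifts
q·nα by at most 1/4. Thus q‖nα‖ is at least 3/4 of the distance from na to the nearest multiple of
q, and a harmonic sum remains. -/
lemma sum_one_div_distNearestInt_le {α : ℝ} {a : ℤ} {q : ℕ} (hq : 0 < q) (hco : IsCoprime a q)
    (hα : |α - a / q| ≤ 1 / (q : ℝ) ^ 2) :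
    ∑ n ∈ Icc 1 (q / 4), 1 / distNearestInt (n * α) ≤ 4 * q * (1 + Real.log q) := by
  have hq' : (0 : ℝ) < q := by exact_mod_cast hq
  set J : ℕ → ℕ := fun n => (n * a % q : ℤ).toNat with hJ
  have hJcast : ∀ n, (J n : ℤ) = n * a % q := fun n =>
    Int.toNat_of_nonneg (Int.emod_nonneg _ (by exact_mod_cast hq.ne'))
  have hlt : ∀ n, J n < q := by
    intro n
    have := Int.emod_lt_of_pos (n * a) (by exact_mod_cast hq : (0 : ℤ) < q)
    rw [← hJcast] at this
    exact_mod_cast this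
  have hpos : ∀ n ∈ Icc 1 (q / 4), 1 ≤ J n := by
    intro n hn
    rw [mem_Icc] at hn
    by_contra h0
    have h1 : (J n : ℤ) = 0 := by omega
    rw [hJcast] at h1
    have h2 : (q : ℤ) ∣ n := hco.symm.dvd_of_dvd_mul_right (Int.dvd_of_emod_eq_zero h1)
    have h3 : q ≤ n := Nat.le_of_dvd (by omega) (by exact_mod_cast h2)
    omega
  have hinj : Set.InjOn J (Icc 1 (q / 4) : Finset ℕ) := by
    intro n hn m hm h
    rw [coe_Icc, Set.mem_Icc] at hn hm
    have h1 : (n * a % q : ℤ) = m * a % q := by rw [← hJcast, ← hJcast, h]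
    have h2 : (q : ℤ) ∣ (n - m) := by
      refine hco.symm.dvd_of_dvd_mul_right ?_
      have := Int.ModEq.dvd (show (m * a : ℤ) ≡ n * a [ZMOD q] from h1.symm)
      rwa [← sub_mul] at this
    have h3 : (n : ℤ) - m = 0 := Int.eq_zero_of_abs_lt_dvd h2 (by rw [abs_lt]; omega)
    omega
  have hterm : ∀ n ∈ Icc 1 (q / 4), 1 / distNearestInt (n * α) ≤
      4 / 3 * q * (1 / (J n : ℝ) + 1 / ((q : ℝ) - J n)) := by
    intro n hn
    have hj1 : (1 : ℝ) ≤ J n := by exact_mod_cast hpos n hn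
    have hj2 : (1 : ℝ) ≤ (q : ℝ) - J n := by
      have : J n + 1 ≤ q := hlt n
      have : ((J n : ℝ)) + 1 ≤ q := by exact_mod_cast this
      linarith
    rw [mem_Icc] at hn
    have hn4 : (4 : ℝ) * n ≤ q := by
      have : 4 * n ≤ q := by omega
      exact_mod_cast this
    obtain ⟨t, ht⟩ : ∃ t : ℤ, (n * a : ℤ) = q * t + J n :=
      ⟨n * a / q, by rw [hJcast]; exact (Int.mul_ediv_add_emod _ _).symm⟩
    have htR : (n * a : ℝ) = q * t + J n := by exact_mod_cast ht
    set z := round (n * α) with hz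
    have herr : |(n : ℝ) * (q * α - a)| ≤ 1 / 4 := by
      have h1 : (n : ℝ) * (q * α - a) = n * q * (α - a / q) := by field_simp
      rw [h1, abs_mul, abs_of_nonneg (by positivity)]
      calc (n : ℝ) * q * |α - a / q| ≤ n * q * (1 / (q : ℝ) ^ 2) := by gcongr
        _ = n / q := by field_simp
        _ ≤ 1 / 4 := by rw [div_le_iff₀ hq']; linarith
    have hqd : q * distNearestInt (n * α) = |q * (t - z) + J n + n * (q * α - a)| := by
      rw [distNearestInt, ← abs_of_pos hq', ← abs_mul, abs_of_pos hq']
      congr 1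
      linear_combination htR
    have hmin : (3 / 4 : ℝ) * min (J n : ℝ) (q - J n) ≤ q * distNearestInt (n * α) := by
      rw [hqd]
      rw [abs_le] at herr
      rcases le_or_gt z t with h | h
      · have h' : (z : ℝ) ≤ t := by exact_mod_cast h
        have := min_le_left (J n : ℝ) (q - J n)
        refine le_trans ?_ (le_abs_self _)
        nlinarith [mul_nonneg hq'.le (sub_nonneg.2 h')]
      · have h' : (t : ℝ) + 1 ≤ z := by exact_mod_cast h
        have := min_le_right (J n : ℝ) (q - J n)
        refine le_trans ?_ (neg_le_abs _)
        nlinarith [mul_nonneg hq'.le (sub_nonneg.2 h')]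
    have hmin1 : (1 : ℝ) ≤ min (J n : ℝ) (q - J n) := le_min hj1 hj2
    have hd : 3 / 4 * min (J n : ℝ) (q - J n) / q ≤ distNearestInt (n * α) := by
      rw [div_le_iff₀ hq']; linarith
    have hinv : 1 / min (J n : ℝ) (q - J n) ≤ 1 / (J n : ℝ) + 1 / ((q : ℝ) - J n) := by
      have h1 : (0 : ℝ) ≤ 1 / (J n : ℝ) := by positivity
      have h2 : (0 : ℝ) ≤ 1 / ((q : ℝ) - J n) := by positivity
      rcases min_choice (J n : ℝ) (q - J n) with h | h <;> rw [h] <;> linarith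
    calc 1 / distNearestInt (n * α) ≤ 1 / (3 / 4 * min (J n : ℝ) (q - J n) / q) := by gcongr
      _ = 4 / 3 * q * (1 / min (J n : ℝ) (q - J n)) := by field_simp
      _ ≤ _ := by gcongr
  have hfull : ∑ j ∈ Ico 1 q, (1 / (j : ℝ) + 1 / ((q : ℝ) - j)) ≤ 2 * (1 + Real.log q) := by
    have h1 : ∑ j ∈ Ico 1 q, 1 / (j : ℝ) ≤ 1 + Real.log q := by
      refine le_trans ?_ (harmonic_le_one_add_log q)
      rw [harmonic_eq_sum_Icc]
      push_cast
      simp only [one_div]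
      exact sum_le_sum_of_subset_of_nonneg (fun j hj => by simp at hj ⊢; omega)
        fun _ _ _ => by positivity
    have h2 : ∑ j ∈ Ico 1 q, 1 / ((q : ℝ) - j) = ∑ j ∈ Ico 1 q, 1 / (j : ℝ) := by
      refine sum_nbij' (fun j => q - j) (fun j => q - j) ?_ ?_ ?_ ?_ ?_
      · intro j hj; simp at hj ⊢; omega
      · intro j hj; simp at hj ⊢; omega
      · intro j hj; simp at hj ⊢; omega
      · intro j hj; simp at hj ⊢; omega
      · intro j hj
        rw [mem_Ico] at hj
        rw [Nat.cast_sub hj.2.le]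
    rw [sum_add_distrib, h2]
    linarith
  have hlog : 0 ≤ Real.log q := Real.log_natCast_nonneg q
  calc ∑ n ∈ Icc 1 (q / 4), 1 / distNearestInt (n * α)
      ≤ ∑ n ∈ Icc 1 (q / 4), 4 / 3 * q * (1 / (J n : ℝ) + 1 / ((q : ℝ) - J n)) := sum_le_sum hterm
    _ = ∑ j ∈ (Icc 1 (q / 4)).image J, 4 / 3 * q * (1 / (j : ℝ) + 1 / ((q : ℝ) - j)) := by
        rw [sum_image hinj]
    _ ≤ ∑ j ∈ Ico 1 q, 4 / 3 * q * (1 / (j : ℝ) + 1 / ((q : ℝ) - j)) := by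
        refine sum_le_sum_of_subset_of_nonneg ?_ ?_
        · intro j hj
          obtain ⟨n, hn, rfl⟩ := mem_image.1 hj
          exact mem_Ico.2 ⟨hpos n hn, hlt n⟩
        · intro j hj _
          have : (j : ℝ) ≤ q := by exact_mod_cast (mem_Ico.1 hj).2.le
          have : (0 : ℝ) ≤ (q : ℝ) - j := by linarith
          positivity
    _ = 4 / 3 * q * ∑ j ∈ Ico 1 q, (1 / (j : ℝ) + 1 / ((q : ℝ) - j)) := by rw [mul_sum]
    _ ≤ 4 / 3 * q * (2 * (1 + Real.log q)) := by gcongr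
    _ ≤ 4 * q * (1 + Real.log q) := by nlinarith

/-- Dirichlet gives infinitely many approximations, while a bounded denominator also bounds the
numerator and leaves finitely many. -/
lemma exists_den_gt_of_irrational {α : ℝ} (hα : Irrational α) (Q : ℕ) :
    ∃ (a : ℤ) (q : ℕ), Q < q ∧ IsCoprime a q ∧ |α - a / q| ≤ 1 / (q : ℝ) ^ 2 := by
  by_contra! hcon
  refine Real.infinite_rat_abs_sub_lt_one_div_den_sq_of_irrational hα ?_
  have hden : ∀ x ∈ {x : ℚ | |α - x| < 1 / (x.den : ℝ) ^ 2}, x.den ≤ Q := by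
    intro x hx
    by_contra! h
    have h1 := hcon x.num x.den h (Int.isCoprime_iff_gcd_eq_one.2 x.reduced)
    rw [← Rat.cast_def] at h1
    exact absurd hx (not_lt.2 h1.le)
  obtain ⟨A, hA⟩ := exists_nat_gt (Q * (|α| + 1))
  refine Set.Finite.of_finite_image (f := fun x : ℚ => (x.num, x.den))
    (((Set.finite_Icc (-(A : ℤ)) A).prod (Set.finite_Icc 0 Q)).subset ?_) ?_
  · rintro _ ⟨x, hx, rfl⟩
    have hd := hden x hx
    have hd1 : (1 : ℝ) ≤ x.den := by exact_mod_cast x.pos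
    refine ⟨?_, Set.mem_Icc.2 ⟨Nat.zero_le _, hd⟩⟩
    have h1 : |(x : ℝ)| ≤ |α| + 1 := by
      have h2 : |α - x| ≤ 1 := hx.le.trans (by
        rw [div_le_one (by positivity)]; exact one_le_pow₀ hd1)
      have h3 := abs_sub_abs_le_abs_sub (x : ℝ) α
      rw [abs_sub_comm] at h3
      linarith
    have h2 : |(x.num : ℝ)| ≤ A := by
      have h3 : (x.num : ℝ) = x.den * x := by
        exact_mod_cast (Rat.den_mul_eq_num x).symm
      rw [h3, abs_mul, Nat.abs_cast]
      refine le_trans ?_ hA.le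
      have : (x.den : ℝ) ≤ Q := by exact_mod_cast hd
      gcongr
    have h4 : |x.num| ≤ A := by exact_mod_cast h2
    exact Set.mem_Icc.2 (abs_le.1 h4)
  · intro x _ x' _ h
    simp only [Prod.mk.injEq] at h
    exact Rat.ext h.1 h.2

/-! ### The detecting kernel. -/

lemma sum_mul_shift_le (w : ℕ → ℝ) (J u : ℕ) :
    ∑ j ∈ range (J - u), w (j + u) * w j ≤ ∑ j ∈ range J, w j ^ 2 := by
  have h1 : ∑ j ∈ range (J - u), w j ^ 2 ≤ ∑ j ∈ range J, w j ^ 2 :=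
    sum_le_sum_of_subset_of_nonneg (range_subset_range.2 (Nat.sub_le J u))
      fun _ _ _ => sq_nonneg _
  have h2 : ∑ j ∈ range (J - u), w (j + u) ^ 2 ≤ ∑ j ∈ range J, w j ^ 2 := by
    have : ∑ j ∈ range (J - u), w (j + u) ^ 2 = ∑ j ∈ Ico u J, w j ^ 2 := by
      rw [sum_Ico_eq_sum_range]
      simp only [add_comm]
    rw [this]
    exact sum_le_sum_of_subset_of_nonneg (fun j hj => by simp at hj ⊢; omega)
      fun _ _ _ => sq_nonneg _
  have h3 : ∑ j ∈ range (J - u), w (j + u) * w j ≤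
      ∑ j ∈ range (J - u), (w (j + u) ^ 2 / 2 + w j ^ 2 / 2) :=
    sum_le_sum fun j _ => by nlinarith [sq_nonneg (w (j + u) - w j)]
  rw [sum_add_distrib, ← sum_div, ← sum_div] at h3
  linarith

/-- The coefficient of the kernel at frequency u is an autocorrelation of `w`, hence at most its
value at lag 0, which is the main term. -/
lemma abs_sum_norm_sq_sub_le (w : ℕ → ℝ) (hw : ∀ j, 0 ≤ w j) (J L : ℕ) (x : ℕ → ℝ) :
    |∑ s ∈ range L, ‖∑ j ∈ range J, (w j : ℂ) * expTurn (x s) ^ j‖ ^ 2 -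
        (∑ j ∈ range J, w j ^ 2) * L| ≤
      2 * (∑ j ∈ range J, w j ^ 2) * ∑ u ∈ Ico 1 J, ‖∑ s ∈ range L, expTurn (u * x s)‖ := by
  set W := ∑ j ∈ range J, w j ^ 2 with hW
  set c : ℕ → ℝ := fun u => ∑ j ∈ range (J - u), w (j + u) * w j with hc
  have hc0 : ∀ u, 0 ≤ c u := fun u => sum_nonneg fun j _ => mul_nonneg (hw _) (hw _)
  have h1 : ∀ s, ‖∑ j ∈ range J, (w j : ℂ) * expTurn (x s) ^ j‖ ^ 2 =
      W + 2 * (∑ u ∈ Ico 1 J, (c u : ℂ) * expTurn (u * x s)).re := by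
    intro s
    rw [norm_sq_sum_range]
    congr 1
    · refine sum_congr rfl fun j _ => ?_
      rw [norm_mul, norm_pow, norm_expTurn, one_pow, mul_one, Complex.norm_real, Real.norm_eq_abs,
        sq_abs]
    · congr 2
      refine sum_congr rfl fun u _ => ?_
      rw [hc]
      push_cast
      rw [sum_mul]
      refine sum_congr rfl fun j _ => ?_
      rw [map_mul, Complex.conj_ofReal, map_pow, conj_expTurn, ← expTurn_nat_mul,
        ← expTurn_nat_mul]
      have : expTurn (u * x s) =
          expTurn (((j + u : ℕ) : ℝ) * x s) * expTurn ((j : ℝ) * -x s) := by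
        rw [← expTurn_add]
        congr 1
        push_cast
        ring
      rw [this]
      ring
  have h2 : ∑ s ∈ range L, ‖∑ j ∈ range J, (w j : ℂ) * expTurn (x s) ^ j‖ ^ 2 - W * L =
      2 * (∑ u ∈ Ico 1 J, (c u : ℂ) * ∑ s ∈ range L, expTurn (u * x s)).re := by
    simp only [h1, sum_add_distrib, sum_const, card_range, nsmul_eq_mul, mul_sum]
    rw [← mul_sum, ← Complex.re_sum, sum_comm]
    ring
  rw [h2, abs_mul, abs_two, mul_assoc]
  refine mul_le_mul_of_nonneg_left ?_ zero_le_two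
  refine (Complex.abs_re_le_norm _).trans ((norm_sum_le _ _).trans ?_)
  rw [mul_sum]
  refine sum_le_sum fun u _ => ?_
  rw [norm_mul, Complex.norm_real, Real.norm_eq_abs, abs_of_nonneg (hc0 u)]
  exact mul_le_mul_of_nonneg_right (sum_mul_shift_le w J u) (norm_nonneg _)

/-- The coefficients of a power of a geometric sum. -/
lemma exists_weights {r H : ℕ} (hr : 1 ≤ r) (hH : 1 ≤ H) : ∃ w : ℕ → ℝ, (∀ j, 0 ≤ w j) ∧
    (∀ z : ℂ, ∑ j ∈ range (r * H), (w j : ℂ) * z ^ j = (∑ a ∈ range H, z ^ a) ^ r) ∧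
    (H : ℝ) ^ (2 * r) ≤ (r * H : ℕ) * ∑ j ∈ range (r * H), w j ^ 2 := by
  set p : Polynomial ℕ := (∑ a ∈ range H, Polynomial.X ^ a) ^ r with hp
  have hdeg : p.natDegree < r * H := by
    have h1 : (∑ a ∈ range H, (Polynomial.X : Polynomial ℕ) ^ a).natDegree ≤ H - 1 := by
      refine Polynomial.natDegree_sum_le_of_forall_le _ _ fun a ha => ?_
      rw [mem_range] at ha
      exact (Polynomial.natDegree_X_pow_le a).trans (by omega)
    refine (Polynomial.natDegree_pow_le_of_le r h1).trans_lt ?_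
    exact Nat.mul_lt_mul_of_pos_left (by omega) (by omega)
  have heval : ∀ z : ℂ, ∑ j ∈ range (r * H), (((p.coeff j : ℝ)) : ℂ) * z ^ j =
      (∑ a ∈ range H, z ^ a) ^ r := by
    intro z
    have h := Polynomial.aeval_eq_sum_range' hdeg z
    rw [hp, map_pow, map_sum] at h
    simp only [map_pow, Polynomial.aeval_X] at h
    rw [h]
    refine sum_congr rfl fun j _ => ?_
    simp [hp]
  refine ⟨fun j => p.coeff j, fun j => Nat.cast_nonneg _, heval, ?_⟩
  -- Evaluation at z = 1; Cauchy–Schwarz over the r * H coefficients then bounds the peak of the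
  -- kernel by its mean.
  have h1 : ∑ j ∈ range (r * H), (p.coeff j : ℝ) = (H : ℝ) ^ r := by
    have := heval 1
    simp only [one_pow, mul_one, sum_const, card_range, nsmul_eq_mul] at this
    exact_mod_cast this
  have h2 := sq_sum_le_card_mul_sum_sq (s := range (r * H)) (f := fun j => (p.coeff j : ℝ))
  rw [h1, card_range, ← pow_mul, mul_comm r 2] at h2
  exact h2

/-! ### Sieving out odd squares. -/

/-- The number of `s` with `2 * j * (j + 1) + (2 * j + 1) ^ 2 * s < M`. -/
def multiplesCount (M j : ℕ) : ℕ := (M + 2 * j * (j + 1)) / (2 * j + 1) ^ 2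

lemma lt_multiplesCount_iff {M j s : ℕ} :
    s < multiplesCount M j ↔ 2 * j * (j + 1) + (2 * j + 1) ^ 2 * s < M := by
  rw [multiplesCount, ← Nat.succ_le_iff, Nat.le_div_iff_mul_le (by positivity), Nat.succ_eq_add_one]
  have h : (s + 1) * (2 * j + 1) ^ 2 =
      2 * j * (j + 1) + (2 * j + 1) ^ 2 * s + 1 + 2 * j * (j + 1) := by ring
  omega

lemma multiplesCount_le_self (M j : ℕ) : multiplesCount M j ≤ M := by
  by_contra! h
  have h1 := lt_multiplesCount_iff.1 h
  nlinarith [Nat.zero_le (2 * j * (j + 1)), Nat.one_le_pow 2 (2 * j + 1) (by omega)]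

lemma multiplesCount_zero (M : ℕ) : multiplesCount M 0 = M := by simp [multiplesCount]

/-- The first admissible m is 2j(j+1), about half the modulus (2j+1)². Rounding therefore costs at
most a factor 2 over the density, and the resulting bound telescopes. -/
lemma multiplesCount_le {M j : ℕ} (hj : 1 ≤ j) :
    (multiplesCount M j : ℝ) ≤ M / 2 * (1 / j - 1 / (j + 1)) := by
  have hj' : (0 : ℝ) < j := by exact_mod_cast hj
  have h0 : (M : ℝ) / 2 * (1 / j - 1 / (j + 1)) = M / (2 * j * (j + 1)) := by field_simp; ring
  rw [h0]
  rcases Nat.eq_zero_or_pos (multiplesCount M j) with h | h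
  · rw [h, Nat.cast_zero]; positivity
  · have h1 : 2 * j * (j + 1) < M := by simpa using lt_multiplesCount_iff.1 h
    have h2 : multiplesCount M j * (2 * j + 1) ^ 2 ≤ M + 2 * j * (j + 1) := Nat.div_mul_le_self _ _
    rw [le_div_iff₀ (by positivity)]
    have h3 : multiplesCount M j * (2 * j * (j + 1)) ≤ M := by nlinarith
    exact_mod_cast h3

lemma sum_one_div_sub (a b : ℕ) (hab : a ≤ b) :
    ∑ j ∈ Ico a b, (1 / (j : ℝ) - 1 / (j + 1)) = 1 / (a : ℝ) - 1 / b := by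
  have := sum_Ico_sub (fun j : ℕ => -(1 / (j : ℝ))) hab
  push_cast at this
  refine (sum_congr rfl fun j _ => ?_).trans (this.trans ?_)
  · ring
  · ring

lemma sum_multiplesCount_le (M : ℕ) {a : ℕ} (ha : 1 ≤ a) (b : ℕ) :
    ∑ j ∈ Ico a b, (multiplesCount M j : ℝ) ≤ M / 2 * (1 / a) := by
  have hM : (0 : ℝ) ≤ M := Nat.cast_nonneg M
  rcases le_or_gt a b with hab | hab
  · calc ∑ j ∈ Ico a b, (multiplesCount M j : ℝ)
        ≤ ∑ j ∈ Ico a b, (M : ℝ) / 2 * (1 / j - 1 / (j + 1)) :=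
          sum_le_sum fun j hj => multiplesCount_le (ha.trans (mem_Ico.1 hj).1)
      _ = M / 2 * (1 / a - 1 / b) := by rw [← mul_sum, sum_one_div_sub a b hab]
      _ ≤ M / 2 * (1 / a) := by
          have : (0 : ℝ) ≤ 1 / b := by positivity
          gcongr
          linarith
  · rw [Ico_eq_empty (by omega), sum_empty]
    positivity

lemma exists_of_not_squarefree {m : ℕ} (h : ¬Squarefree (2 * m + 1)) :
    ∃ j s : ℕ, 1 ≤ j ∧ m = 2 * j * (j + 1) + (2 * j + 1) ^ 2 * s := by
  rw [Nat.squarefree_iff_prime_squarefree] at h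
  push Not at h
  obtain ⟨p, hp, c, hc⟩ := h
  have hodd : Odd (p * p * c) := by rw [← hc]; exact odd_two_mul_add_one m
  rw [Nat.odd_mul, Nat.odd_mul] at hodd
  obtain ⟨⟨⟨j, hj⟩, -⟩, ⟨s, hs⟩⟩ := hodd
  refine ⟨j, s, ?_, ?_⟩
  · have := hp.two_le
    omega
  · subst hj hs
    nlinarith

lemma sum_biUnion_le_sum {ι : Type*} {F : ℕ → ℝ} (hF : ∀ m, 0 ≤ F m) (s : Finset ι)
    (t : ι → Finset ℕ) : ∑ m ∈ s.biUnion t, F m ≤ ∑ i ∈ s, ∑ m ∈ t i, F m := by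
  classical
  induction s using Finset.induction_on with
  | empty => simp
  | insert i s hi ih =>
    rw [biUnion_insert, sum_insert hi]
    have h1 := sum_union_inter (s₁ := t i) (s₂ := s.biUnion t) (f := F)
    have h2 : 0 ≤ ∑ m ∈ t i ∩ s.biUnion t, F m := sum_nonneg fun m _ => hF m
    linarith

/-- The contribution of the non-squarefree values is covered by progressions. -/
lemma sum_le_of_le_on_squarefree {F : ℕ → ℝ} (hF0 : ∀ m, 0 ≤ F m) (hF1 : ∀ m, F m ≤ 1) {M n₀ : ℕ}
    {κ : ℝ} (hκ : 0 ≤ κ) (hF : ∀ m < M, n₀ ≤ m → Squarefree (2 * m + 1) → F m ≤ κ) (D : ℕ) :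
    ∑ m ∈ range M, F m ≤ n₀ + M * κ + ∑ j ∈ Ico 1 (D + 1), ∑ s ∈ range (multiplesCount M j),
      F (2 * j * (j + 1) + (2 * j + 1) ^ 2 * s) + M / 2 * (1 / (D + 1)) := by
  classical
  set R : ℕ → ℝ := fun j => ∑ s ∈ range (multiplesCount M j),
      F (2 * j * (j + 1) + (2 * j + 1) ^ 2 * s) with hR
  have hR0 : ∀ j, 0 ≤ R j := fun j => sum_nonneg fun _ _ => hF0 _
  have h1 : ∑ m ∈ range M with Squarefree (2 * m + 1), F m ≤ n₀ + M * κ := by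
    calc ∑ m ∈ range M with Squarefree (2 * m + 1), F m
        ≤ ∑ m ∈ range M, ((if m < n₀ then 1 else 0) + κ) := by
          rw [sum_filter]
          refine sum_le_sum fun m hm => ?_
          have h := hF m (mem_range.1 hm)
          have h' := hF1 m
          split_ifs with h2 h3 <;> first | linarith | linarith [h (not_lt.1 h3) h2]
      _ = #{m ∈ range M | m < n₀} + M * κ := by
          rw [sum_add_distrib, sum_const, card_range, nsmul_eq_mul]
          simp
      _ ≤ n₀ + M * κ := by
          gcongr
          calc #{m ∈ range M | m < n₀} ≤ #(range n₀) :=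
                card_le_card fun m hm => mem_range.2 (mem_filter.1 hm).2
            _ = n₀ := card_range _
  -- The range of j is long enough to be exhaustive, since j ≤ 2j(j+1) ≤ m < M.
  have h2 : ∑ m ∈ range M with ¬Squarefree (2 * m + 1), F m ≤ ∑ j ∈ Ico 1 (D + 1 + M), R j := by
    have hsub : {m ∈ range M | ¬Squarefree (2 * m + 1)} ⊆
        (Ico 1 (D + 1 + M)).biUnion fun j => (range (multiplesCount M j)).image
          fun s => 2 * j * (j + 1) + (2 * j + 1) ^ 2 * s := by
      intro m hm
      obtain ⟨hm1, hm2⟩ := mem_filter.1 hm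
      obtain ⟨j, s, hj, hjs⟩ := exists_of_not_squarefree hm2
      rw [mem_range] at hm1
      refine mem_biUnion.2 ⟨j, mem_Ico.2 ⟨hj, ?_⟩, mem_image.2 ⟨s, mem_range.2 ?_, hjs.symm⟩⟩
      · have : j ≤ 2 * j * (j + 1) := by nlinarith
        have := Nat.zero_le ((2 * j + 1) ^ 2 * s)
        omega
      · rw [lt_multiplesCount_iff]
        omega
    refine (sum_le_sum_of_subset_of_nonneg hsub fun _ _ _ => hF0 _).trans ?_
    refine (sum_biUnion_le_sum hF0 _ _).trans ?_
    refine sum_le_sum fun j _ => ?_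
    rw [sum_image]
    intro s _ s' _ h
    have h' : (2 * j + 1) ^ 2 * s = (2 * j + 1) ^ 2 * s' := Nat.add_left_cancel h
    exact Nat.eq_of_mul_eq_mul_left (by positivity) h'
  have h3 : ∑ j ∈ Ico (D + 1) (D + 1 + M), R j ≤ M / 2 * (1 / (D + 1)) := by
    have h := sum_multiplesCount_le M (a := D + 1) (by omega) (D + 1 + M)
    push_cast at h
    refine le_trans (sum_le_sum fun j _ => ?_) h
    refine (sum_le_sum fun s _ => hF1 _).trans_eq ?_
    simp
  rw [← sum_filter_add_sum_filter_not (range M) fun m => Squarefree (2 * m + 1)]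
  rw [← sum_Ico_consecutive R (show 1 ≤ D + 1 by omega) (show D + 1 ≤ D + 1 + M by omega)] at h2
  linarith

/-- If no `n = 2 (2 m + 1)` with `2 m + 1` squarefree has `φ n` close to an integer, then one of
the exponential sums along the multiples of an odd square is large. -/
lemma half_le_sum_norm_of_forall_le_distNearestInt (φ : ℕ → ℝ) {r H M n₀ D : ℕ} (hr : 1 ≤ r)
    (hH : 1 ≤ H) {δ : ℝ} (hδ : 0 < δ)
    (h : ∀ m < M, n₀ ≤ m → Squarefree (2 * m + 1) → δ ≤ distNearestInt (φ (2 * (2 * m + 1)))) :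
    (M : ℝ) / 2 ≤ (r * H : ℕ) * (n₀ + M * (1 / (2 * H * δ)) ^ (2 * r) + M / 2 * (1 / (D + 1))) +
      2 * ∑ j ∈ range (D + 1), ∑ u ∈ Ico 1 (r * H), ‖∑ s ∈ range (multiplesCount M j),
        expTurn (u * φ (2 * ((2 * j + 1) ^ 2 * (2 * s + 1))))‖ := by
  obtain ⟨w, hw0, hwz, hwW⟩ := exists_weights hr hH
  set J := r * H with hJ
  set W := ∑ j ∈ range J, w j ^ 2 with hW
  have hH' : (0 : ℝ) < H := by exact_mod_cast hH
  have hJ' : (0 : ℝ) < (J : ℕ) := by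
    have : 0 < J := Nat.mul_pos hr hH
    exact_mod_cast this
  have hHr : (0 : ℝ) < (H : ℝ) ^ (2 * r) := by positivity
  have hWpos : 0 < W := by
    by_contra! hneg
    nlinarith
  set K : ℝ → ℝ := fun x => ‖∑ j ∈ range J, (w j : ℂ) * expTurn x ^ j‖ ^ 2 with hK
  have hKeq : ∀ x, K x = ‖∑ a ∈ range H, expTurn x ^ a‖ ^ (2 * r) := by
    intro x
    rw [hK]
    simp only [hwz, norm_pow]
    rw [← pow_mul, mul_comm r 2]
  have hK1 : ∀ x, K x ≤ (H : ℝ) ^ (2 * r) := by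
    intro x
    rw [hKeq]
    gcongr
    refine (norm_sum_le _ _).trans ?_
    simp [norm_expTurn]
  have hKδ : ∀ x, δ ≤ distNearestInt x → K x ≤ (H : ℝ) ^ (2 * r) * (1 / (2 * H * δ)) ^ (2 * r) := by
    intro x hx
    rw [hKeq, ← mul_pow]
    gcongr
    refine (norm_sum_expTurn_pow_le x (hδ.trans_le hx).ne' H).trans ?_
    calc 1 / (2 * distNearestInt x) ≤ 1 / (2 * δ) := by gcongr
      _ = H * (1 / (2 * H * δ)) := by field_simp
  have hK0 : ∀ x, 0 ≤ K x := fun x => sq_nonneg _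
  set T : ℕ → ℝ := fun j => ∑ u ∈ Ico 1 J, ‖∑ s ∈ range (multiplesCount M j),
        expTurn (u * φ (2 * ((2 * j + 1) ^ 2 * (2 * s + 1))))‖ with hT
  have hmain : ∀ j, |∑ s ∈ range (multiplesCount M j),
      K (φ (2 * (2 * (2 * j * (j + 1) + (2 * j + 1) ^ 2 * s) + 1))) - W * multiplesCount M j| ≤
      2 * W * T j := by
    intro j
    refine (abs_sum_norm_sq_sub_le w hw0 J (multiplesCount M j) _).trans_eq ?_
    rw [hT]
    congr 1
    refine sum_congr rfl fun u _ => ?_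
    congr 1
    refine sum_congr rfl fun s _ => ?_
    congr 4
    ring
  have hsum := sum_le_of_le_on_squarefree (M := M) (n₀ := n₀)
    (F := fun m => K (φ (2 * (2 * m + 1))) / (H : ℝ) ^ (2 * r))
    (κ := (1 / (2 * H * δ)) ^ (2 * r)) (fun m => div_nonneg (hK0 _) hHr.le)
    (fun m => (div_le_one hHr).2 (hK1 _)) (by positivity)
    (fun m hm hn hs => by rw [div_le_iff₀' hHr]; exact hKδ _ (h m hm hn hs)) D
  set A : ℝ := n₀ + M * (1 / (2 * H * δ)) ^ (2 * r) + M / 2 * (1 / (D + 1)) with hA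
  have hA0 : 0 ≤ A := by positivity
  -- The case j = 0 has modulus 1 and is the full sum over odd numbers.
  have hlow : W * (M - 2 * T 0) ≤ ∑ m ∈ range M, K (φ (2 * (2 * m + 1))) := by
    have := (abs_le.1 (hmain 0)).1
    simp only [multiplesCount_zero, mul_zero, zero_mul, zero_add, one_pow, one_mul] at this
    linarith
  have hup : ∑ j ∈ Ico 1 (D + 1), ∑ s ∈ range (multiplesCount M j),
      K (φ (2 * (2 * (2 * j * (j + 1) + (2 * j + 1) ^ 2 * s) + 1))) ≤
      W * (M / 2 + 2 * ∑ j ∈ Ico 1 (D + 1), T j) := by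
    have h1 := sum_multiplesCount_le M le_rfl (D + 1)
    calc _ ≤ ∑ j ∈ Ico 1 (D + 1), (W * multiplesCount M j + 2 * W * T j) :=
          sum_le_sum fun j _ => by linarith [(abs_le.1 (hmain j)).2]
      _ = W * (∑ j ∈ Ico 1 (D + 1), (multiplesCount M j : ℝ) + 2 * ∑ j ∈ Ico 1 (D + 1), T j) := by
          rw [sum_add_distrib, ← mul_sum, ← mul_sum]; ring
      _ ≤ _ := by
          gcongr
          simpa using h1
  simp only [← sum_div] at hsum
  have hsum' : ∑ m ∈ range M, K (φ (2 * (2 * m + 1))) ≤ H ^ (2 * r) * A +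
      ∑ j ∈ Ico 1 (D + 1), ∑ s ∈ range (multiplesCount M j),
        K (φ (2 * (2 * (2 * j * (j + 1) + (2 * j + 1) ^ 2 * s) + 1))) := by
    rw [div_le_iff₀ hHr] at hsum
    refine hsum.trans_eq ?_
    rw [hA]
    field_simp
    ring
  have hfin : W * (M - 2 * T 0) ≤ W * (J * A + (M / 2 + 2 * ∑ j ∈ Ico 1 (D + 1), T j)) := by
    have h1 : (H : ℝ) ^ (2 * r) * A ≤ J * W * A := mul_le_mul_of_nonneg_right hwW hA0
    nlinarith
  have hfin' := le_of_mul_le_mul_left hfin hWpos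
  have h0 : ∑ j ∈ range (D + 1), T j = T 0 + ∑ j ∈ Ico 1 (D + 1), T j := by
    rw [range_eq_Ico, sum_eq_sum_Ico_succ_bot (by omega)]
  rw [h0]
  linarith

/-! ### Exponential sums along progressions. -/

lemma sum_linearBound_le {α : ℝ} (hα : Irrational α) {a : ℤ} {q : ℕ} (hq : 0 < q)
    (hco : IsCoprime a q) (happ : |α - a / q| ≤ 1 / (q : ℝ) ^ 2) {N c R : ℕ} (hc : 1 ≤ c)
    (hcR : 4 * (c * R) ≤ q) :
    ∑ r ∈ Icc 1 R, linearBound N (((c * r : ℕ) : ℝ) * α) ≤ 4 * q * (1 + Real.log q) := by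
  refine le_trans ?_ (sum_one_div_distNearestInt_le hq hco happ)
  calc ∑ r ∈ Icc 1 R, linearBound N (((c * r : ℕ) : ℝ) * α)
      = ∑ r ∈ Icc 1 R, 1 / distNearestInt (((c * r : ℕ) : ℝ) * α) := by
        refine sum_congr rfl fun r hr => ?_
        have hcr : c * r ≠ 0 := by
          rw [mem_Icc] at hr
          exact Nat.mul_ne_zero (by omega) (by omega)
        rw [linearBound, if_neg (distNearestInt_ne_zero (hα.natCast_mul hcr))]
    _ = ∑ n ∈ (Icc 1 R).image (c * ·), 1 / distNearestInt ((n : ℝ) * α) := by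
        rw [sum_image]
        intro r _ r' _ h
        exact Nat.eq_of_mul_eq_mul_left hc h
    _ ≤ _ := by
        refine sum_le_sum_of_subset_of_nonneg ?_
          fun _ _ _ => div_nonneg zero_le_one (distNearestInt_nonneg _)
        intro n hn
        obtain ⟨r, hr, rfl⟩ := mem_image.1 hn
        rw [mem_Icc] at hr ⊢
        have h1 : c * r ≤ c * R := Nat.mul_le_mul_left c hr.2
        exact ⟨Nat.mul_pos hc hr.1, by omega⟩

/-- Weyl's inequality on average over the multiples of a polynomial. -/
lemma mul_sum_norm_pow_le {α : ℝ} (hα : Irrational α) {a : ℤ} {q : ℕ} (hq : 0 < q)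
    (hco : IsCoprime a q) (happ : |α - a / q| ≤ 1 / (q : ℝ) ^ 2) {N L X B c i : ℕ} (hN : 1 ≤ N)
    (hL : L ≤ N) (hB1 : 1 ≤ B) (hc : 1 ≤ c) (hB : ∀ n, n ≠ 0 → n ≤ X * N ^ i → #n.divisors ≤ B)
    (hcq : 4 * ((i + 1).factorial * c * (X * N ^ i)) ≤ q) {P : Polynomial ℝ}
    (hP : P.natDegree ≤ i + 1) (hPc : P.coeff (i + 1) = c * α) :
    X * (N : ℝ) ^ (i + 1) * (∑ u ∈ Ico 1 X, ‖∑ s ∈ range L, expTurn (u * P.eval (s : ℝ))‖) ^ 2 ^ i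
      ≤ (X : ℝ) ^ 2 ^ i * (2 * N) ^ 2 ^ i * B ^ i * (5 * q * (1 + Real.log q)) := by
  set K := 2 ^ i with hK
  obtain ⟨K', hK'⟩ := Nat.exists_eq_succ_of_ne_zero (show K ≠ 0 by positivity)
  set T : ℕ → ℝ := fun u => ‖∑ s ∈ range L, expTurn (u * P.eval (s : ℝ))‖ with hT
  have hT0 : ∀ u, 0 ≤ T u := fun u => norm_nonneg _
  have hlog : 0 ≤ Real.log q := Real.log_natCast_nonneg q
  rcases Nat.eq_zero_or_pos X with hX | hX
  · subst hX
    have : (0 : ℝ) ^ K = 0 := zero_pow (by positivity)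
    simp [this]
  have hX' : (0 : ℝ) < X := by exact_mod_cast hX
  have hpow : X * (∑ u ∈ Ico 1 X, T u) ^ K ≤ (X : ℝ) ^ K * ∑ u ∈ Icc 1 X, T u ^ K := by
    have hsub : ∑ u ∈ Ico 1 X, T u ≤ ∑ u ∈ Icc 1 X, T u :=
      sum_le_sum_of_subset_of_nonneg Ico_subset_Icc_self fun _ _ _ => hT0 _
    have h := pow_sum_div_card_le_sum_pow (s := Icc 1 X) (f := T) (fun u _ => hT0 u) K'
    rw [Nat.card_Icc, Nat.add_sub_cancel, div_le_iff₀ (by positivity)] at h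
    have h0 : 0 ≤ ∑ u ∈ Ico 1 X, T u := sum_nonneg fun _ _ => hT0 _
    rw [hK', Nat.succ_eq_add_one]
    calc X * (∑ u ∈ Ico 1 X, T u) ^ (K' + 1) ≤ X * (∑ u ∈ Icc 1 X, T u) ^ (K' + 1) := by gcongr
      _ ≤ X * ((∑ u ∈ Icc 1 X, T u ^ (K' + 1)) * X ^ K') := by gcongr
      _ = _ := by ring
  have hweyl : ∀ u ∈ Icc 1 X, (N : ℝ) ^ (i + 1) * T u ^ K ≤
      (2 * N : ℝ) ^ K * weylBound N i (u * (c * α)) := by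
    intro u _
    have h := weyl_inequality i hL (P := Polynomial.C (u : ℝ) * P)
      ((Polynomial.natDegree_C_mul_le _ _).trans hP)
    simp only [Polynomial.eval_mul, Polynomial.eval_C, Polynomial.coeff_C_mul, hPc] at h
    exact h
  have hsum := sum_weylBound_le hN hB1 i X (c * α) hB
  have hlin : ∑ r ∈ Icc 1 (X * N ^ i), linearBound N ((((i + 1).factorial * r : ℕ) : ℝ) * (c * α))
      ≤ 4 * q * (1 + Real.log q) := by
    refine le_trans (le_of_eq ?_) (sum_linearBound_le (N := N) (c := (i + 1).factorial * c) hα hq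
      hco happ (Nat.mul_pos (Nat.factorial_pos _) hc) hcq)
    refine sum_congr rfl fun r _ => ?_
    congr 1
    push_cast
    ring
  -- The degenerate zero-shift terms cost one more q(1 + log q), turning the constant 4 into 5.
  have hsmall : (i : ℝ) * X * N ^ i ≤ q * (1 + Real.log q) := by
    have h1 : i ≤ (i + 1).factorial * c :=
      calc i ≤ (i + 1).factorial := (Nat.le_succ i).trans (Nat.self_le_factorial _)
        _ ≤ _ := Nat.le_mul_of_pos_right _ hc
    have h2 : i * (X * N ^ i) ≤ q := by
      have := Nat.mul_le_mul_right (X * N ^ i) h1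
      omega
    have h3 : (i : ℝ) * (X * N ^ i) ≤ q := by exact_mod_cast h2
    nlinarith [Nat.cast_nonneg (α := ℝ) q]
  calc X * (N : ℝ) ^ (i + 1) * (∑ u ∈ Ico 1 X, T u) ^ K
      = (N : ℝ) ^ (i + 1) * (X * (∑ u ∈ Ico 1 X, T u) ^ K) := by ring
    _ ≤ (N : ℝ) ^ (i + 1) * ((X : ℝ) ^ K * ∑ u ∈ Icc 1 X, T u ^ K) := by gcongr
    _ = (X : ℝ) ^ K * ∑ u ∈ Icc 1 X, (N : ℝ) ^ (i + 1) * T u ^ K := by rw [← mul_sum]; ring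
    _ ≤ (X : ℝ) ^ K * ∑ u ∈ Icc 1 X, (2 * N : ℝ) ^ K * weylBound N i (u * (c * α)) :=
        mul_le_mul_of_nonneg_left (sum_le_sum hweyl) (by positivity)
    _ = (X : ℝ) ^ K * (2 * N) ^ K * ∑ u ∈ Icc 1 X, weylBound N i (u * (c * α)) := by
        rw [← mul_sum]; ring
    _ ≤ (X : ℝ) ^ K * (2 * N) ^ K * (B ^ i * (q * (1 + Real.log q) + 4 * q * (1 + Real.log q))) := by
        refine mul_le_mul_of_nonneg_left (hsum.trans ?_) (by positivity)
        gcongr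
    _ = _ := by ring

lemma natDegree_comp_progression {f : Polynomial ℝ} {k : ℕ} (hf : f.natDegree = k) {b : ℝ}
    (hb : b ≠ 0) (c : ℝ) :
    (f.comp (Polynomial.C b * Polynomial.X + Polynomial.C c)).natDegree = k ∧
      (f.comp (Polynomial.C b * Polynomial.X + Polynomial.C c)).coeff k
        = b ^ k * f.leadingCoeff := by
  have h1 : (Polynomial.C b * Polynomial.X + Polynomial.C c).natDegree = 1 :=
    Polynomial.natDegree_linear hb
  have h2 : (f.comp (Polynomial.C b * Polynomial.X + Polynomial.C c)).natDegree = k := by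
    rw [Polynomial.natDegree_comp, h1, mul_one, hf]
  refine ⟨h2, ?_⟩
  have h3 := Polynomial.leadingCoeff_comp (p := f)
    (q := Polynomial.C b * Polynomial.X + Polynomial.C c) (by rw [h1]; exact one_ne_zero)
  rw [Polynomial.leadingCoeff, h2, Polynomial.leadingCoeff_linear hb, hf] at h3
  rw [h3, mul_comm]

/-! ### Choice of parameters. -/

lemma exists_one_add_log_le (E : ℕ) :
    ∃ Y : ℕ, ∀ y ≥ Y, 1 + Real.log (((y + 1) ^ E : ℕ) : ℝ) ≤ y := by
  have h := (Real.isLittleO_log_id_atTop.def (c := 1 / (2 * (E + 1))) (by positivity))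
  obtain ⟨x₀, hx₀⟩ := Filter.eventually_atTop.1 h
  obtain ⟨Y, hY⟩ := exists_nat_ge x₀
  refine ⟨max Y 3, fun y hy => ?_⟩
  have hy1 : (Y : ℝ) ≤ y := by exact_mod_cast (le_max_left _ _).trans hy
  have hy3 : (3 : ℝ) ≤ y := by exact_mod_cast (le_max_right _ _).trans hy
  have h1 := hx₀ ((y : ℝ) + 1) (by linarith)
  rw [Real.norm_eq_abs, id, Real.norm_eq_abs, abs_of_nonneg (by positivity : (0 : ℝ) ≤ y + 1)] at h1
  have h2 := (le_abs_self _).trans h1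
  push_cast
  rw [Real.log_pow]
  have h3 : (E : ℝ) * Real.log (y + 1) ≤ E * (1 / (2 * (E + 1)) * (y + 1)) := by gcongr
  have h4 : (E : ℝ) * (1 / (2 * (E + 1)) * (y + 1)) ≤ (y + 1) / 2 := by
    rw [show (E : ℝ) * (1 / (2 * (E + 1)) * (y + 1)) = E / (E + 1) * ((y + 1) / 2) by field_simp]
    refine mul_le_of_le_one_left (by positivity) ?_
    rw [div_le_one (by positivity)]
    linarith
  linarith

lemma exists_pow_le_lt_succ_pow {E Y q : ℕ} (hE : E ≠ 0) (hq : Y ^ E < q) :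
    ∃ y, Y ≤ y ∧ y ^ E ≤ q ∧ q < (y + 1) ^ E := by
  have hex : ∃ z, q < z ^ E :=
    ⟨q + 1, (Nat.lt_succ_self q).trans_le (Nat.le_self_pow hE _)⟩
  classical
  have hfind := Nat.find_spec hex
  have hY : Y < Nat.find hex := by
    by_contra! h
    exact absurd (hfind.trans_le (Nat.pow_le_pow_left h E)) (by omega)
  obtain ⟨y, hy⟩ := Nat.exists_eq_succ_of_ne_zero (show Nat.find hex ≠ 0 by omega)
  refine ⟨y, by omega, ?_, by rw [← Nat.succ_eq_add_one, ← hy]; exact hfind⟩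
  exact not_lt.1 (Nat.find_min hex (show y < Nat.find hex by omega))

/-- Since γ/4 = 4^(-k), raising y^(4^k t) to the power -γ/4 + ε gives at least y^(5-t). The spare
factor y ≥ 4 pays for the 4 in the bound on n. -/
lemma one_div_pow_le_rpow {k t y n : ℕ} {ε : ℝ} (hy : 4 ≤ y) (ht : 5 ≤ t)
    (hε : 5 ≤ 4 ^ k * t * ε) (hε0 : 0 < ε) (hn : 1 ≤ n) (hn4 : n ≤ 4 * y ^ (4 ^ k * t)) :
    1 / (y : ℝ) ^ (t - 4) ≤ (n : ℝ) ^ (-(gammaExp k / 4) + ε) := by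
  have hy4 : (4 : ℝ) ≤ y := by exact_mod_cast hy
  have hy0 : (0 : ℝ) < y := by linarith
  have hn1 : (1 : ℝ) ≤ n := by exact_mod_cast hn
  have h4k : (0 : ℝ) < 4 ^ k := by positivity
  have hγ : gammaExp k / 4 = 1 / 4 ^ k := by
    rw [gammaExp, zpow_sub₀ (by norm_num), zpow_natCast, zpow_one]
    field_simp
  rw [hγ]
  set s : ℝ := -(1 / 4 ^ k) + ε with hs
  rcases le_or_gt 0 s with h | h
  · refine le_trans ?_ (Real.one_le_rpow hn1 h)
    rw [div_le_one (by positivity)]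
    exact one_le_pow₀ (by linarith)
  · have hs1 : -1 ≤ s := by
      have : 1 / (4 : ℝ) ^ k ≤ 1 := by
        rw [div_le_one h4k]; exact one_le_pow₀ (by norm_num)
      linarith
    have hle : (n : ℝ) ≤ 4 * (y : ℝ) ^ (4 ^ k * t) := by exact_mod_cast hn4
    have hexp : -((t - 4 : ℕ) : ℝ) + 1 ≤ ((4 ^ k * t : ℕ) : ℝ) * s := by
      rw [Nat.cast_sub (by omega), hs]
      push_cast
      have : (4 : ℝ) ^ k * t * (-(1 / 4 ^ k) + ε) = -t + 4 ^ k * t * ε := by field_simp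
      rw [this]
      linarith
    calc 1 / (y : ℝ) ^ (t - 4) = (y : ℝ) ^ (-((t - 4 : ℕ) : ℝ)) := by
          rw [Real.rpow_neg hy0.le, Real.rpow_natCast, one_div]
      _ = (y : ℝ)⁻¹ * (y : ℝ) ^ (-((t - 4 : ℕ) : ℝ) + 1) := by
          rw [Real.rpow_add hy0, Real.rpow_one]; field_simp
      _ ≤ (4 : ℝ)⁻¹ * (y : ℝ) ^ (((4 ^ k * t : ℕ) : ℝ) * s) := by
          gcongr
          linarith
      _ ≤ (4 : ℝ) ^ s * ((y : ℝ) ^ (4 ^ k * t)) ^ s := by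
          rw [← Real.rpow_natCast, ← Real.rpow_mul hy0.le]
          gcongr
          rw [← Real.rpow_neg_one]
          exact Real.rpow_le_rpow_of_exponent_le (by norm_num) hs1
      _ = (4 * (y : ℝ) ^ (4 ^ k * t)) ^ s := by
          rw [Real.mul_rpow (by norm_num) (by positivity)]
      _ ≤ (n : ℝ) ^ s := Real.rpow_le_rpow_of_nonpos (by linarith) hle h.le

/-- This fixes the exponent 4^k: 2 · 2^i is the loss from differencing and 2(i + 1) the loss from
leading coefficients of size d^(2k). Equality holds for i = 0. -/
lemma two_mul_two_pow_add_le (i : ℕ) : 2 * 2 ^ i + 2 * (i + 1) ≤ 4 ^ (i + 1) := by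
  have h1 : i + 1 ≤ 2 ^ i := Nat.succ_le_of_lt Nat.lt_two_pow_self
  have h2 : 2 ^ i ≤ 4 ^ i := Nat.pow_le_pow_left (by norm_num) i
  rw [pow_succ]
  omega

/-- The exponential sums along the multiples of an odd square are small. -/
lemma sum_norm_progression_le {i t y q : ℕ} {f : Polynomial ℝ} (hdeg : f.natDegree = i + 1)
    (hf : Irrational f.leadingCoeff) {a : ℤ} (hco : IsCoprime a q)
    (happ : |f.leadingCoeff - a / q| ≤ 1 / (q : ℝ) ^ 2) (ht : 5 ≤ t) {E : ℕ}
    (hE : E = 2 * (i + 1) * t + t - 2 + 4 ^ (i + 1) * t * i)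
    (hqy : y ^ E ≤ q) (hyq : q < (y + 1) ^ E)
    (hdiv : ∀ n : ℕ, n ≠ 0 → n ≤ y ^ E → #n.divisors ≤ y)
    (hlog : 1 + Real.log (((y + 1) ^ E : ℕ) : ℝ) ≤ y)
    (hy1 : 4 * (i + 1).factorial * 16 ^ (i + 1) * t ≤ y)
    (hy2 : 32 ^ 2 ^ i * t ^ 2 ^ i * (5 * 2 ^ E) ≤ y) {j : ℕ} (hj : j < y ^ t) :
    ∑ u ∈ Ico 1 (t * y ^ (t - 3)), ‖∑ s ∈ range (multiplesCount (y ^ (4 ^ (i + 1) * t)) j),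
        expTurn (u * f.eval (((2 * ((2 * j + 1) ^ 2 * (2 * s + 1)) : ℕ)) : ℝ))‖ ≤
      (y : ℝ) ^ (4 ^ (i + 1) * t) / (16 * y ^ t) := by
  set e := 4 ^ (i + 1) * t with he
  set d := 2 * j + 1 with hd
  set X := t * y ^ (t - 3) with hX
  set K := 2 ^ i with hK
  have hty : t ≤ y := by
    refine le_trans ?_ hy1
    exact Nat.le_mul_of_pos_left t (by positivity)
  have hypos : 0 < y := by omega
  have hq : 0 < q := (Nat.pow_pos hypos).trans_le hqy
  have hXE : X * (y ^ e) ^ i ≤ y ^ (t - 2 + e * i) := by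
    calc X * (y ^ e) ^ i ≤ y * y ^ (t - 3) * (y ^ e) ^ i := by rw [hX]; gcongr
      _ = y ^ (t - 2 + e * i) := by
          rw [← pow_mul, ← pow_succ', ← pow_add]
          congr 1
          omega
  have hdle : d ≤ 2 * y ^ t := by omega
  -- `E` is chosen for this: 2(i+1)t from the powers of d, t - 3 from `X`, e·i from the differencing
  -- shifts, and one more y for the constants.
  have hcq : 4 * ((i + 1).factorial * (4 * d ^ 2) ^ (i + 1) * (X * (y ^ e) ^ i)) ≤ q := by
    refine le_trans ?_ hqy
    calc 4 * ((i + 1).factorial * (4 * d ^ 2) ^ (i + 1) * (X * (y ^ e) ^ i))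
        ≤ 4 * ((i + 1).factorial * (4 * (2 * y ^ t) ^ 2) ^ (i + 1) * (X * (y ^ e) ^ i)) := by
          gcongr
      _ = (4 * (i + 1).factorial * 16 ^ (i + 1) * t) *
            ((y ^ t) ^ (2 * (i + 1)) * y ^ (t - 3) * (y ^ e) ^ i) := by
          rw [show 4 * (2 * y ^ t) ^ 2 = 16 * (y ^ t) ^ 2 by ring, mul_pow, ← pow_mul (y ^ t), hX]
          ring
      _ ≤ y * ((y ^ t) ^ (2 * (i + 1)) * y ^ (t - 3) * (y ^ e) ^ i) := by gcongr
      _ = y ^ E := by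
          rw [← pow_mul, ← pow_mul, ← pow_add, ← pow_add, ← pow_succ']
          congr 1
          have : t * (2 * (i + 1)) = 2 * (i + 1) * t := by ring
          rw [hE, this]
          omega
  have hB : ∀ n, n ≠ 0 → n ≤ X * (y ^ e) ^ i → #n.divisors ≤ y := by
    intro n hn hle
    refine hdiv n hn (hle.trans (hXE.trans (Nat.pow_le_pow_right hypos ?_)))
    rw [hE]
    omega
  obtain ⟨hPd, hPc⟩ := natDegree_comp_progression hdeg
    (b := 4 * (d : ℝ) ^ 2) (by positivity) (2 * (d : ℝ) ^ 2)
  set P := f.comp (Polynomial.C (4 * (d : ℝ) ^ 2) * Polynomial.X + Polynomial.C (2 * (d : ℝ) ^ 2))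
    with hP
  have hmain := mul_sum_norm_pow_le hf hq hco happ (N := y ^ e) (X := X) (B := y)
    (c := (4 * d ^ 2) ^ (i + 1)) (i := i) (Nat.pow_pos hypos) (multiplesCount_le_self (y ^ e) j)
    hypos (Nat.pow_pos (by positivity)) hB hcq hPd.le (by rw [hPc]; push_cast; ring)
  have heval : ∀ s : ℕ, P.eval (s : ℝ) = f.eval (((2 * (d ^ 2 * (2 * s + 1)) : ℕ)) : ℝ) := by
    intro s
    rw [hP, Polynomial.eval_comp]
    simp only [Polynomial.eval_add, Polynomial.eval_mul, Polynomial.eval_C, Polynomial.eval_X]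
    congr 1
    push_cast
    ring
  simp only [heval] at hmain
  set S := ∑ u ∈ Ico 1 X, ‖∑ s ∈ range (multiplesCount (y ^ e) j),
        expTurn (u * f.eval (((2 * (d ^ 2 * (2 * s + 1)) : ℕ)) : ℝ))‖ with hS
  have hy0 : (0 : ℝ) < y := by exact_mod_cast hypos
  have hy1' : (1 : ℝ) ≤ y := by exact_mod_cast hypos
  by_contra! hlt
  have hX0 : (0 : ℝ) < X := by
    have : 0 < X := Nat.mul_pos (by omega) (Nat.pow_pos hypos)
    exact_mod_cast this
  push_cast at hmain
  have hqlog : (q : ℝ) * (1 + Real.log q) ≤ 2 ^ E * (y : ℝ) ^ (E + 1) := by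
    have h1 : (q : ℝ) ≤ (((y + 1) ^ E : ℕ) : ℝ) := by exact_mod_cast hyq.le
    have h2 : 1 + Real.log q ≤ y := by
      refine le_trans ?_ hlog
      have : (0 : ℝ) < q := by exact_mod_cast hq
      gcongr
    have h3 : (q : ℝ) ≤ (2 * y) ^ E := by
      refine h1.trans ?_
      push_cast
      gcongr
      linarith
    calc (q : ℝ) * (1 + Real.log q) ≤ (2 * y) ^ E * y := by gcongr
      _ = _ := by rw [mul_pow]; ring
  have hlow : (X : ℝ) * ((y : ℝ) ^ e) ^ (i + 1) * ((y : ℝ) ^ e / (16 * y ^ t)) ^ K <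
      (X : ℝ) * ((y : ℝ) ^ e) ^ (i + 1) * S ^ K := by
    have : ((y : ℝ) ^ e / (16 * y ^ t)) ^ K < S ^ K :=
      pow_lt_pow_left₀ hlt (by positivity) (by positivity)
    gcongr
  have hcmp := hlow.trans_le hmain
  have hstep : (X : ℝ) * ((y : ℝ) ^ e) ^ (i + 1) <
      (32 * X * y ^ t) ^ K * y ^ i * (5 * (2 ^ E * (y : ℝ) ^ (E + 1))) := by
    have hpos : (0 : ℝ) < ((y : ℝ) ^ e / (16 * y ^ t)) ^ K := by positivity
    refine lt_of_mul_lt_mul_right (hcmp.trans_le ?_) hpos.le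
    have h1 : (X : ℝ) ^ K * (2 * (y : ℝ) ^ e) ^ K =
        (32 * X * y ^ t) ^ K * ((y : ℝ) ^ e / (16 * y ^ t)) ^ K := by
      rw [← mul_pow, ← mul_pow]
      congr 1
      field_simp
      norm_num
    rw [h1]
    calc _ = (32 * X * (y : ℝ) ^ t) ^ K * y ^ i * (5 * (q * (1 + Real.log q))) *
          ((y : ℝ) ^ e / (16 * y ^ t)) ^ K := by ring
      _ ≤ _ := by gcongr
  have hnat : X * (y ^ e) ^ (i + 1) < (32 * X * y ^ t) ^ K * y ^ i * (5 * (2 ^ E * y ^ (E + 1))) := by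
    exact_mod_cast hstep
  refine absurd hnat (not_lt.2 ?_)
  -- Comparison of powers of y, where the final + 1 on the left pays for the numerical constants.
  have hexp : (t - 3) * K + t * K + i + (E + 1) + 1 ≤ (t - 3) + e * (i + 1) := by
    have h1 : i + 1 ≤ K := Nat.succ_le_of_lt Nat.lt_two_pow_self
    have h2 := Nat.mul_le_mul_right t (two_mul_two_pow_add_le i)
    rw [← he, ← hK] at h2
    obtain ⟨t', rfl⟩ : ∃ t', t = t' + 3 := ⟨t - 3, by omega⟩
    rw [hE, Nat.add_sub_cancel]
    have h3 : 2 * (i + 1) * (t' + 3) + (t' + 3) - 2 = 2 * (i + 1) * (t' + 3) + t' + 1 := by omega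
    rw [h3]
    nlinarith
  calc (32 * X * y ^ t) ^ K * y ^ i * (5 * (2 ^ E * y ^ (E + 1)))
      = (32 ^ K * t ^ K * (5 * 2 ^ E)) * y ^ ((t - 3) * K + t * K + i + (E + 1)) := by
        rw [hX]
        ring
    _ ≤ y * y ^ ((t - 3) * K + t * K + i + (E + 1)) := by gcongr
    _ = y ^ ((t - 3) * K + t * K + i + (E + 1) + 1) := by rw [pow_succ']
    _ ≤ y ^ ((t - 3) + e * (i + 1)) := Nat.pow_le_pow_right hypos hexp
    _ = y ^ (t - 3) * (y ^ e) ^ (i + 1) := by rw [pow_add, pow_mul]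
    _ ≤ X * (y ^ e) ^ (i + 1) := by
        gcongr
        exact Nat.le_mul_of_pos_left _ (by omega)

/-! ### Conclusion. -/

lemma squarefree_two_mul_of_squarefree {m : ℕ} (hm : 1 ≤ m) (h : Squarefree (2 * m + 1)) :
    Squarefree (2 * (2 * m + 1)) ∧ 2 ≤ (2 * (2 * m + 1)).primeFactors.card := by
  have hcop : Nat.Coprime 2 (2 * m + 1) := by simp
  refine ⟨(Nat.squarefree_mul hcop).2 ⟨Nat.prime_two.squarefree, h⟩, ?_⟩
  rw [hcop.primeFactors_mul, card_union_of_disjoint hcop.disjoint_primeFactors,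
    Nat.prime_two.primeFactors, card_singleton]
  have : 0 < #(2 * m + 1).primeFactors := card_pos.2 (Nat.nonempty_primeFactors.2 (by omega))
  omega

theorem theorem4 (k : ℕ) (hk : 1 ≤ k) (f : Polynomial ℝ) (hdeg : f.natDegree = k)
    (hf : Irrational f.leadingCoeff) (ε : ℝ) (hε : 0 < ε) :
    {n : ℕ | Squarefree n ∧ 2 ≤ n.primeFactors.card ∧
      distNearestInt (f.eval (n : ℝ)) < (n : ℝ) ^ (-(gammaExp k / 4) + ε)}.Infinite := by
  intro hfin
  obtain ⟨b, hb⟩ := hfin.bddAbove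
  obtain ⟨i, rfl⟩ : ∃ i, k = i + 1 := ⟨k - 1, by omega⟩
  obtain ⟨t₀, ht₀⟩ := exists_nat_ge (5 / (4 ^ (i + 1) * ε))
  set t := max t₀ 5 with ht
  have ht5 : 5 ≤ t := le_max_right _ _
  have htε : 5 ≤ 4 ^ (i + 1) * t * ε := by
    have h1 : (t₀ : ℝ) ≤ t := by exact_mod_cast le_max_left _ _
    rw [div_le_iff₀ (by positivity)] at ht₀
    calc (5 : ℝ) ≤ t₀ * (4 ^ (i + 1) * ε) := ht₀
      _ ≤ t * (4 ^ (i + 1) * ε) := by gcongr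
      _ = _ := by ring
  set E := 2 * (i + 1) * t + t - 2 + 4 ^ (i + 1) * t * i with hE
  obtain ⟨Y₁, hY₁⟩ := exists_card_divisors_le E
  obtain ⟨Y₂, hY₂⟩ := exists_one_add_log_le E
  set Y := Y₁ + Y₂ + 4 * (i + 1).factorial * 16 ^ (i + 1) * t +
    32 ^ 2 ^ i * t ^ 2 ^ i * (5 * 2 ^ E) + 16 * t + 16 * t * (b + 1) with hY
  -- The approximation comes first and y is read off from q, since good denominators cannot be
  -- prescribed.
  obtain ⟨a, q, hq, hco, happ⟩ := exists_den_gt_of_irrational hf (Y ^ E)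
  obtain ⟨y, hyY, hqy, hyq⟩ := exists_pow_le_lt_succ_pow (by omega) hq
  have hy16 : 16 * t ≤ y := by omega
  have hyb : 16 * t * (b + 1) ≤ y := by omega
  have hypos : 0 < y := by omega
  set e := 4 ^ (i + 1) * t with he
  have hsmall : ∀ j < y ^ t, _ := fun j hj => sum_norm_progression_le hdeg hf hco happ ht5 hE hqy hyq
    (hY₁ y (by omega)) (hY₂ y (by omega)) (by omega) (by omega) hj
  have hy0 : (0 : ℝ) < y := by exact_mod_cast hypos
  have hfar : ∀ m < y ^ e, b + 1 ≤ m → Squarefree (2 * m + 1) →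
      1 / (y : ℝ) ^ (t - 4) ≤ distNearestInt (f.eval ((2 * (2 * m + 1) : ℕ) : ℝ)) := by
    intro m hm hbm hsq
    refine (one_div_pow_le_rpow (by omega) ht5 htε hε (n := 2 * (2 * m + 1)) (by omega)
      (by rw [← he]; omega)).trans ?_
    by_contra! hlt
    obtain ⟨h1, h2⟩ := squarefree_two_mul_of_squarefree (by omega) hsq
    have : 2 * (2 * m + 1) ≤ b := hb ⟨h1, h2, hlt⟩
    omega
  have hmain := half_le_sum_norm_of_forall_le_distNearestInt (fun n : ℕ => f.eval (n : ℝ)) (r := t)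
    (H := y ^ (t - 3)) (M := y ^ e) (n₀ := b + 1) (D := y ^ t - 1) (by omega) (Nat.pow_pos hypos)
    (δ := 1 / (y : ℝ) ^ (t - 4)) (by positivity) hfar
  rw [Nat.sub_add_cancel (Nat.pow_pos hypos)] at hmain
  have hDcast : (((y ^ t - 1 : ℕ) : ℝ)) + 1 = (y : ℝ) ^ t := by
    rw [Nat.cast_sub (Nat.pow_pos hypos)]
    push_cast
    ring
  rw [hDcast] at hmain
  have hsum : ∑ j ∈ range (y ^ t), ∑ u ∈ Ico 1 (t * y ^ (t - 3)),
      ‖∑ s ∈ range (multiplesCount (y ^ e) j),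
        expTurn (u * f.eval (((2 * ((2 * j + 1) ^ 2 * (2 * s + 1)) : ℕ)) : ℝ))‖ ≤
      (y : ℝ) ^ e / 16 := by
    refine (sum_le_sum fun j hj => hsmall j (mem_range.1 hj)).trans_eq ?_
    rw [sum_const, card_range, nsmul_eq_mul]
    push_cast
    field_simp
    rw [he]
  have hM : (0 : ℝ) < (y : ℝ) ^ e := by positivity
  have hy16' : 16 * (t : ℝ) ≤ y := by exact_mod_cast hy16
  have hy1 : (1 : ℝ) ≤ y := by exact_mod_cast hypos
  have het : t - 3 + 1 ≤ e := by
    have : t ≤ e := Nat.le_mul_of_pos_left t (by positivity)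
    omega
  have herr1 : (t : ℝ) * y ^ (t - 3) * (b + 1) ≤ y ^ e / 16 := by
    have h1 : 16 * (t * y ^ (t - 3) * (b + 1)) ≤ y ^ e := by
      calc 16 * (t * y ^ (t - 3) * (b + 1)) = 16 * t * (b + 1) * y ^ (t - 3) := by ring
        _ ≤ y * y ^ (t - 3) := by gcongr
        _ = y ^ (t - 3 + 1) := by rw [pow_succ']
        _ ≤ y ^ e := Nat.pow_le_pow_right hypos het
    have h2 : 16 * ((t : ℝ) * y ^ (t - 3) * (b + 1)) ≤ y ^ e := by exact_mod_cast h1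
    linarith
  -- The kernel length exceeds 1/δ by a factor y, so with r = t its decay (2y)^(-2t) beats the
  -- t·y^(t-3) frequencies.
  have hHδ : (1 : ℝ) / (2 * (y : ℝ) ^ (t - 3) * (1 / (y : ℝ) ^ (t - 4))) = 1 / (2 * y) := by
    rw [show t - 3 = (t - 4) + 1 by omega, pow_succ]
    field_simp
  have herr2 : (t : ℝ) * y ^ (t - 3) * (y ^ e * (1 / (2 * y)) ^ (2 * t)) ≤ y ^ e / 16 := by
    have h1 : (1 / (2 * (y : ℝ))) ^ (2 * t) ≤ (1 / y) ^ (t - 3 + 1) := by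
      calc (1 / (2 * (y : ℝ))) ^ (2 * t) ≤ (1 / y) ^ (2 * t) := by
            gcongr
            linarith
        _ ≤ (1 / (y : ℝ)) ^ (t - 3 + 1) :=
            pow_le_pow_of_le_one (by positivity) (by rw [div_le_one hy0]; exact hy1) (by omega)
    calc (t : ℝ) * y ^ (t - 3) * (y ^ e * (1 / (2 * y)) ^ (2 * t))
        ≤ t * y ^ (t - 3) * (y ^ e * (1 / y) ^ (t - 3 + 1)) := by gcongr
      _ = t / y * y ^ e := by rw [div_pow, one_pow, pow_succ]; field_simp
      _ ≤ 1 / 16 * y ^ e := by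
          refine mul_le_mul_of_nonneg_right ?_ hM.le
          rw [div_le_div_iff₀ hy0 (by norm_num)]
          linarith
      _ = _ := by ring
  have herr3 : (t : ℝ) * y ^ (t - 3) * (y ^ e / 2 * (1 / y ^ t)) ≤ y ^ e / 16 := by
    have h1 : (y : ℝ) ^ (t - 3) * y ≤ y ^ t := by
      rw [← pow_succ]
      exact pow_le_pow_right₀ hy1 (by omega)
    have h2 : (t : ℝ) * y ^ (t - 3) * (1 / y ^ t) ≤ 1 / 16 := by
      rw [mul_one_div, div_le_div_iff₀ (by positivity) (by norm_num)]
      have : (0 : ℝ) < (y : ℝ) ^ (t - 3) := by positivity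
      nlinarith
    calc (t : ℝ) * y ^ (t - 3) * (y ^ e / 2 * (1 / y ^ t))
        = y ^ e / 2 * (t * y ^ (t - 3) * (1 / y ^ t)) := by ring
      _ ≤ y ^ e / 2 * (1 / 16) := by gcongr
      _ ≤ y ^ e / 16 := by linarith
  push_cast at hmain hsum
  rw [hHδ] at hmain
  -- Three errors of at most M/16 and twice M/16 from the exponential sums total 5M/16 < M/2.
  linarith
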